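/- Let $\mathbb{K}\in\{\mathbb{R},\mathbb{C}\}$, $n\ge 1$, and let ${\rm C}$ be the Clifford algebra over $\mathbb{K}$ with identity $e$ and generators $e_1,\dots,e_n$ satisfying $e_ae_b+e_be_a=2\eta_{ab}e$, where $\eta$ is a diagonal matrix with entries $\pm1$ (so ${\rm C}={C}\!\ell(\mathbb{R}^{p,q})$, $p+q=n$, with arbitrary signature if $\mathbb{K}=\mathbb{R}$, and ${\rm C}\cong{C}\!\ell(\mathbb{C}^n)$ if $\mathbb{K}=\mathbb{C}$). Let ${\rm C}^k$ be the subspace of grade $k$, spanned by the products $e_{a_1}\cdots e_{a_k}$, $a_1<\dots<a_k$ (so ${\rm C}^k=0$ for $k>n$); put ${\rm C}^{(j)}=\bigoplus_{k\equiv j\bmod 2}{\rm C}^k$, ${\rm C}^{\overline m}=\bigoplus_{k\equiv m\bmod 4}{\rm C}^k$, and write several upper indices for the sum of the corresponding subspaces, e.g. ${\rm C}^{0\overline{23}n}={\rm C}^0+{\rm C}^{\overline2}+{\rm C}^{\overline3}+{\rm C}^n$. Let ${\rm Z}$ be the center of ${\rm C}$, let $S^\times$ be the set of elements of $S\subseteq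 {\rm C}$ that are invertible in ${\rm C}$, let $T\mapsto\tilde T$ be the reversion and $T\mapsto\hat T$ the grade involution. Put $${\rm P}={\rm Z}^\times({\rm C}^{(0)\times}\cup{\rm C}^{(1)\times}),\quad {\rm A}=\{T\in{\rm C}^\times:\tilde TT\in{\rm Z}^\times\},\quad {\rm B}=\{T\in{\rm C}^\times:\hat{\tilde T}T\in{\rm Z}^\times\},$$ $${\rm Q}=\{T\in{\rm P}:\tilde TT\in{\rm Z}^\times\},\quad {\rm Q}'=\{T\in{\rm P}:\tilde TT\in({\rm C}^0+{\rm C}^n)^\times\},$$ and let $\gamma={\rm C}^{02}$ for even $n$ and $\gamma={\rm C}^{02n}$ for odd $n$. Then ${\rm P},{\rm A},{\rm B},{\rm Q},{\rm Q}'$ are Lie groups over $\mathbb{K}$ (subgroups of ${\rm C}^\times$ that are embedded submanifolds). Their Lie algebras $\mathfrak p,\mathfrak a,\mathfrak b,\mathfrak q,\mathfrak q'$ (where the Lie algebra of $G\subseteq{\rm C}^\times$ is $\{X\in{\rm C}:\exp(tX)\in G\ \forall t\in\mathbb{R}\}$ with the commutator as bracket) are the following subspaces, with the following dimensions over $\mathbb{K}$,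 which are also the dimensions of the groups: * $\mathfrak p={\rm C}^{(0)n}$ of dimension $2^{n-1}+1$ for odd $n$; $\mathfrak p={\rm C}^{(0)}$ of dimension $2^{n-1}$ for even $n$. * $\mathfrak a={\rm C}^{0\overline{23}n}$ of dimension $2^{n-1}-2^{\frac{n-1}2}\sin\frac{\pi(n+1)}4+2$ for $n\equiv1\bmod4$; $\mathfrak a={\rm C}^{0\overline{23}}$ of dimension $2^{n-1}-2^{\frac{n-1}2}\sin\frac{\pi(n+1)}4+1$ for $n\equiv0,2,3\bmod4$. * $\mathfrak b={\rm C}^{0\overline{12}n}$ of dimension $2^{n-1}-2^{\frac{n-1}2}\cos\frac{\pi(n+1)}4+2$ for $n\equiv3\bmod4$; $\mathfrak b={\rm C}^{0\overline{12}}$ of dimension $2^{n-1}-2^{\frac{n-1}2}\cos\frac{\pi(n+1)}4+1$ for $n\equiv0,1,2\bmod4$. * $\mathfrak q={\rm C}^{0\overline2n}$ of dimension $2^{n-2}-2^{\frac{n-2}2}\cos\frac{\pi n}4+2$ for odd $n$; $\mathfrak q={\rm C}^{0\overline2}$ of dimension $2^{n-2}-2^{\frac{n-2}2}\cos\frac{\pi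 n}4+1$ for even $n$. * $\mathfrak q'={\rm C}^{0\overline2n}$ of dimension $2^{n-2}-2^{\frac{n-2}2}\cos\frac{\pi n}4+2$ for $n\equiv0,1,3\bmod4$; $\mathfrak q'={\rm C}^{0\overline2}$ of dimension $2^{n-2}-2^{\frac{n-2}2}\cos\frac{\pi n}4+1$ for $n\equiv2\bmod4$. Moreover $\gamma\subseteq\mathfrak q\subseteq\mathfrak p$, $\mathfrak q\subseteq\mathfrak a$, $\mathfrak q\subseteq\mathfrak b$ and $\mathfrak q=\mathfrak a\cap\mathfrak p=\mathfrak b\cap\mathfrak p=\mathfrak a\cap\mathfrak b$; if $n\le3$, then $\mathfrak q=\mathfrak p=\mathfrak a$; if $n=4$, then $\mathfrak q\ne\mathfrak p$, $\mathfrak q\ne\mathfrak a$, $\mathfrak p\ne\mathfrak a$; if $n\le5$, then $\gamma=\mathfrak q$; if $n=6$, then $\gamma\ne\mathfrak q$. If $n\equiv0\bmod4$, then $\mathfrak q\subseteq\mathfrak q'\subseteq\mathfrak p$, $\gamma\subseteq\mathfrak q'$ and $\mathfrak q\ne\mathfrak q'$; moreover $\mathfrak q'=\mathfrak p$ if $n=4$,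 and $\mathfrak q'\ne\mathfrak p$ if $n\ge8$. -/

import Mathlib

open scoped ContDiff Pointwise

noncomputable section

namespace CliffordLie

/-! ### The Clifford algebra and its canonical topology -/

section Basic

variable {𝕜 : Type*} [RCLike 𝕜] {n : ℕ}

/-- The quadratic form `x ↦ ∑ a, η a * (x a) ^ 2` on `𝕜ⁿ`. -/
abbrev quadForm (η : Fin n → 𝕜) : QuadraticForm 𝕜 (Fin n → 𝕜) :=
  QuadraticMap.weightedSumSquares 𝕜 η

/-- The Clifford algebra with generators `e a` and relations
`e a * e b + e b * e a = 2 η_{ab}`, where `(η_{ab})` is the diagonal matrix with diagonal `η`. -/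
abbrev Cl (η : Fin n → 𝕜) : Type _ := CliffordAlgebra (quadForm η)

/-- A basis of the underlying vector space (used only to write down a norm). -/
def clBasis (η : Fin n → 𝕜) : Module.Basis (Finset (Fin n)) 𝕜 (Cl η) :=
  letI : Invertible (2 : 𝕜) := invertibleOfNonzero two_ne_zero
  (Pi.basisFun 𝕜 (Fin n)).ExteriorAlgebra.map (CliffordAlgebra.equivExterior (quadForm η)).symm

instance instFiniteDimensionalCl (η : Fin n → 𝕜) : FiniteDimensional 𝕜 (Cl η) :=
  (clBasis η).finiteDimensional_of_finite

/-- A submultiplicative norm on the Clifford algebra: the operator norm of left multiplication.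
The algebra is finite dimensional, so all norms are equivalent, and the choice of this one is
irrelevant for convergence and differentiability. -/
instance instNormedRingCl (η : Fin n → 𝕜) : NormedRing (Cl η) :=
  letI : NormedRing (Matrix (Finset (Fin n)) (Finset (Fin n)) 𝕜) := Matrix.linftyOpNormedRing
  NormedRing.induced (Cl η) (Matrix (Finset (Fin n)) (Finset (Fin n)) 𝕜)
    (Algebra.leftMulMatrix (clBasis η)) (Algebra.leftMulMatrix_injective (clBasis η))

instance instNormedAlgebraCl (η : Fin n → 𝕜) : NormedAlgebra 𝕜 (Cl η) :=
  letI : NormedRing (Matrix (Finset (Fin n)) (Finset (Fin n)) 𝕜) := Matrix.linftyOpNormedRing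
  letI : NormedAlgebra 𝕜 (Matrix (Finset (Fin n)) (Finset (Fin n)) 𝕜) :=
    Matrix.linftyOpNormedAlgebra
  NormedAlgebra.induced 𝕜 (Cl η) (Matrix (Finset (Fin n)) (Finset (Fin n)) 𝕜)
    (Algebra.leftMulMatrix (clBasis η))

/-- The commutator bracket `⁅U, V⁆ = U * V - V * U`. -/
instance instLieRingCl (η : Fin n → 𝕜) : LieRing (Cl η) := LieRing.ofAssociativeRing

instance instLieAlgebraCl (η : Fin n → 𝕜) : LieAlgebra 𝕜 (Cl η) :=
  LieAlgebra.ofAssociativeAlgebra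

/-! ### Distinguished subspaces -/

/-- The generators. -/
def e (η : Fin n → 𝕜) (a : Fin n) : Cl η := CliffordAlgebra.ι (quadForm η) (Pi.single a 1)

/-- The product `e a₁ * ⋯ * e aₖ` for `s = {a₁ < ⋯ < aₖ}` (it is `1` for `s = ∅`). -/
def eProd (η : Fin n → 𝕜) (s : Finset (Fin n)) : Cl η :=
  ((s.sort (· ≤ ·)).map (e η)).prod

/-- The subspace of grade `k` (it is `⊥` for `k > n`). -/
def grade (η : Fin n → 𝕜) (k : ℕ) : Submodule 𝕜 (Cl η) :=
  Submodule.span 𝕜 {x | ∃ s : Finset (Fin n), s.card = k ∧ x = eProd η s}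

/-- The even (`j = 0`) and the odd (`j = 1`) subspace. -/
def parity (η : Fin n → 𝕜) (j : ℕ) : Submodule 𝕜 (Cl η) :=
  ⨆ k : ℕ, ⨆ _ : k % 2 = j, grade η k

/-- The sum of the subspaces of grades congruent to `m` modulo `4` (for `m < 4`). -/
def quat (η : Fin n → 𝕜) (m : ℕ) : Submodule 𝕜 (Cl η) :=
  ⨆ k : ℕ, ⨆ _ : k % 4 = m, grade η k

/-- The center. -/
def center (η : Fin n → 𝕜) : Submodule 𝕜 (Cl η) :=
  Subalgebra.toSubmodule (Subalgebra.center 𝕜 (Cl η))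

/-- The subspace `γ`. -/
def gammaAlg (η : Fin n → 𝕜) : Submodule 𝕜 (Cl η) :=
  if Even n then grade η 0 ⊔ grade η 2 else grade η 0 ⊔ grade η 2 ⊔ grade η n

/-! ### The groups -/

/-- The invertible elements of a subspace. -/
def unitsIn {η : Fin n → 𝕜} (S : Submodule 𝕜 (Cl η)) : Set (Cl η)ˣ := {T | (T : Cl η) ∈ S}

/-- The norm function: reversion of `T`, times `T`. -/
def psi {η : Fin n → 𝕜} (T : Cl η) : Cl η := CliffordAlgebra.reverse T * T

/-- The norm function: grade involution of the reversion of `T`, times `T`. -/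
def chi {η : Fin n → 𝕜} (T : Cl η) : Cl η :=
  CliffordAlgebra.involute (CliffordAlgebra.reverse T) * T

def groupP (η : Fin n → 𝕜) : Set (Cl η)ˣ :=
  unitsIn (center η) * (unitsIn (parity η 0) ∪ unitsIn (parity η 1))

def groupA (η : Fin n → 𝕜) : Set (Cl η)ˣ :=
  {T | ∃ W ∈ unitsIn (center η), psi (T : Cl η) = W}

def groupB (η : Fin n → 𝕜) : Set (Cl η)ˣ :=
  {T | ∃ W ∈ unitsIn (center η), chi (T : Cl η) = W}

def groupQ (η : Fin n → 𝕜) : Set (Cl η)ˣ :=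
  {T | T ∈ unitsIn (center η) * (unitsIn (parity η 0) ∪ unitsIn (parity η 1)) ∧
    ∃ W ∈ unitsIn (center η), psi (T : Cl η) = W}

def groupQ' (η : Fin n → 𝕜) : Set (Cl η)ˣ :=
  {T | T ∈ unitsIn (center η) * (unitsIn (parity η 0) ∪ unitsIn (parity η 1)) ∧
    ∃ W ∈ unitsIn (grade η 0 ⊔ grade η n), psi (T : Cl η) = W}

end Basic

/-! ### Lie groups of invertible elements and their Lie algebras -/

/-- `M` is an embedded smooth (holomorphic, if `𝕜 = ℂ`) submanifold of `E` modelled on the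
subspace `F`: around each point of `M` there is a smooth chart of `E` that straightens `M`
to `F`. -/
def IsEmbeddedSubmanifold {𝕜 E : Type*} [RCLike 𝕜] [NormedAddCommGroup E] [NormedSpace 𝕜 E]
    (M : Set E) (F : Submodule 𝕜 E) : Prop :=
  ∀ x ∈ M, ∃ φ : OpenPartialHomeomorph E E, x ∈ φ.source ∧
    ContDiffOn 𝕜 ∞ φ φ.source ∧ ContDiffOn 𝕜 ∞ φ.symm φ.target ∧
    ∀ y ∈ φ.source, (y ∈ M ↔ φ y ∈ F)

/-- `G` is a Lie subgroup of the group of invertible elements of the Clifford algebra (a subgroup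
and an embedded submanifold), and `𝔤` is its Lie algebra: the generators of the one-parameter
subgroups `t ↦ exp (t X)`, `t ∈ ℝ`, that stay in `G`, with the commutator as bracket.
The dimension of the manifold `G` is that of `𝔤`. -/
structure IsLieGroupWithLieAlgebra {𝕜 : Type*} [RCLike 𝕜] {n : ℕ} {η : Fin n → 𝕜}
    (G : Set (Cl η)ˣ) (𝔤 : LieSubalgebra 𝕜 (Cl η)) : Prop where
  isSubgroup : ∃ H : Subgroup (Cl η)ˣ, (H : Set (Cl η)ˣ) = G
  isSubmanifold : IsEmbeddedSubmanifold ((fun T : (Cl η)ˣ => (T : Cl η)) '' G) 𝔤.toSubmodule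
  mem_iff : ∀ X : Cl η, X ∈ 𝔤 ↔
    ∀ t : ℝ, ∃ T ∈ G, (T : Cl η) = NormedSpace.exp ((t : 𝕜) • X)

end CliffordLie

end

/-!
The five groups are closed subgroups of the group of invertible elements of a finite dimensional
algebra, so that each of them is an embedded submanifold modelled on the space of the generators of
its one-parameter subgroups (`isEmbeddedSubmanifold_of_isClosed`). The proof of this closed
subgroup theorem is Cartan's: in the chart `X + Y ↦ exp X * exp Y`, where `X` is a generator and
`Y` is in a complement of the space of generators, points of the group near `1` have `Y = 0`, since
otherwise a limit of the directions of such `Y → 0` would be a generator in the complement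
(`eventually_eq_zero_of_exp_mem`). The chart is analytic over `𝕜`, as the space of generators is a
subspace over `𝕜` in the cases at hand.

All five groups are defined by two kinds of closed conditions. For an automorphism `θ`, the
condition that `θ T * T⁻¹` is central corresponds to the condition that `θ X - X` is central
(`isClosedWithLieAlgebra_twist`). For an anti-automorphism `τ`, the condition that `τ T * T` lies in
a subalgebra `K` corresponds to the condition that `τ X + X` lies in `K`
(`isClosedWithLieAlgebra_norm`). Differentiation at `1` gives the linear condition; conversely, the
linear condition makes the expression for `T = exp X` the exponential of an element of `K`. The
groups `A`, `B` are of the second kind, for the reversion and the Clifford conjugation. The group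
`P` is of the first kind, for the grade involution (`groupP_eq`), and `Q`, `Q'` are cut out of `P`
by conditions of the second kind.

The grade involution, the reversion and the Clifford conjugation act on the ordered monomials in
the generators, which form a basis (`eBasis`), by signs depending on the grade only, and the center
is a sum of grades (`center_eq`). Hence each linear condition describes a sum of grades
(`apply_mem_gradeSet_iff`), and the relations between the Lie algebras are relations between sets
of natural numbers modulo `4`. The dimensions are sums of binomial coefficients over residue classes
modulo `4`, which the expansion of `(1 + i) ^ n` evaluates (`chooseMod_sub`).
-/

noncomputable section

namespace CliffordLie

open Filter Topology

/-! ### The closed subgroup theorem -/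

section ClosedSubgroup

variable {𝕜 A : Type*} [RCLike 𝕜] [NormedRing A] [NormedAlgebra 𝕜 A] [CompleteSpace A]

variable (𝕜) in
/-- The exponential of `x`, as an invertible element. The scalar field serves only to justify the
convergence of the exponential series. -/
def expUnit (x : A) : Aˣ :=
  letI : NormedAlgebra ℚ A := .restrictScalars ℚ 𝕜 A
  ⟨NormedSpace.exp x, NormedSpace.exp (-x),
    by rw [← NormedSpace.exp_add_of_commute (Commute.refl x).neg_right]; simp,
    by rw [← NormedSpace.exp_add_of_commute (Commute.refl x).neg_left]; simp⟩

@[simp] theorem val_expUnit (x : A) : (expUnit 𝕜 x : A) = NormedSpace.exp x := rfl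

theorem val_inv_expUnit (x : A) : ((expUnit 𝕜 x)⁻¹ : Aˣ) = expUnit 𝕜 (-x) := by
  ext; rfl

theorem exp_add_of_commute' (𝕜 : Type*) [RCLike 𝕜] {A : Type*} [NormedRing A] [NormedAlgebra 𝕜 A]
    [CompleteSpace A] {x y : A} (h : Commute x y) :
    NormedSpace.exp (x + y) = NormedSpace.exp x * NormedSpace.exp y :=
  let : NormedAlgebra ℚ A := .restrictScalars ℚ 𝕜 A
  NormedSpace.exp_add_of_commute h

theorem expUnit_nsmul (m : ℕ) (x : A) : expUnit 𝕜 (m • x) = expUnit 𝕜 x ^ m := by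
  let : NormedAlgebra ℚ A := .restrictScalars ℚ 𝕜 A
  ext
  rw [val_expUnit, NormedSpace.exp_nsmul, Units.val_pow_eq_pow_val, val_expUnit]

variable (𝕜) in
theorem contDiff_exp {m : WithTop ℕ∞} : ContDiff 𝕜 m (NormedSpace.exp : A → A) :=
  contDiff_iff_contDiffAt.2 fun x => (NormedSpace.exp_analytic x).contDiffAt

theorem continuous_expUnit : Continuous (expUnit 𝕜 : A → Aˣ) := by
  refine Units.isOpenEmbedding_val.isEmbedding.continuous_iff.2 ?_
  exact (contDiff_exp 𝕜 (m := 0)).continuous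

/-- A limit direction of elements of a closed subgroup that converge to `1` generates a
one-parameter subgroup: `exp (t Y)` is the limit of the powers `exp (Yₖ) ^ ⌊t / ‖Yₖ‖⌋`. -/
theorem expUnit_smul_mem_of_tendsto {H : Subgroup Aˣ} (hH : IsClosed (H : Set Aˣ))
    {u : ℕ → A} {Y : A} (hu : Tendsto u atTop (𝓝 0)) (hu0 : ∀ k, u k ≠ 0)
    (huH : ∀ k, expUnit 𝕜 (u k) ∈ H)
    (hY : Tendsto (fun k => ((‖u k‖⁻¹ : ℝ) : 𝕜) • u k) atTop (𝓝 Y)) (t : ℝ) :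
    expUnit 𝕜 ((t : 𝕜) • Y) ∈ H := by
  wlog ht : 0 ≤ t generalizing t
  · have h := this (-t) (by linarith)
    rw [← H.inv_mem_iff, val_inv_expUnit]
    simpa using h
  have hpos : ∀ k, 0 < ‖u k‖ := fun k => norm_pos_iff.2 (hu0 k)
  have hnorm : Tendsto (fun k => ‖u k‖) atTop (𝓝 0) := by simpa using hu.norm
  have hm : Tendsto (fun k => (⌊t / ‖u k‖⌋₊ : ℝ) * ‖u k‖) atTop (𝓝 t) := by
    refine tendsto_of_tendsto_of_tendsto_of_le_of_le (g := fun k => t - ‖u k‖) (h := fun _ => t)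
      (by simpa using hnorm.const_sub t) tendsto_const_nhds (fun k => ?_) (fun k => ?_)
    · have h1 := (Nat.lt_floor_add_one (t / ‖u k‖)).le
      rw [div_le_iff₀ (hpos k)] at h1
      simp only
      linarith
    · have h1 := Nat.floor_le (div_nonneg ht (hpos k).le)
      rwa [le_div_iff₀ (hpos k)] at h1
  have hm' : Tendsto (fun k => (((⌊t / ‖u k‖⌋₊ : ℝ) * ‖u k‖ : ℝ) : 𝕜)) atTop (𝓝 (t : 𝕜)) :=
    (RCLike.continuous_ofReal.tendsto t).comp hm
  have hlim : Tendsto (fun k => expUnit 𝕜 (⌊t / ‖u k‖⌋₊ • u k)) atTop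
      (𝓝 (expUnit 𝕜 ((t : 𝕜) • Y))) := by
    refine (continuous_expUnit.tendsto _).comp ((hm'.smul hY).congr fun k => ?_)
    rw [smul_smul, ← RCLike.ofReal_mul, mul_assoc, mul_inv_cancel₀ (hpos k).ne', mul_one,
      RCLike.ofReal_natCast, Nat.cast_smul_eq_nsmul]
  refine hH.mem_of_tendsto hlim (Eventually.of_forall fun k => ?_)
  rw [expUnit_nsmul]
  exact H.pow_mem (huH k) _

variable [FiniteDimensional 𝕜 A]

/-- Near `0`, a product `exp X * exp Y` with `X` in the Lie algebra of a closed subgroup and `Y`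
in a complement of it lies in the subgroup only if `Y = 0`. Otherwise, by compactness of the unit
sphere, the directions of the elements `Y` accumulate at a unit vector of the complement which
belongs to the Lie algebra. -/
theorem eventually_eq_zero_of_exp_mem {H : Subgroup Aˣ} (hH : IsClosed (H : Set Aˣ))
    {F V : Submodule 𝕜 A} (hF : ∀ X, X ∈ F ↔ ∀ t : ℝ, expUnit 𝕜 ((t : 𝕜) • X) ∈ H)
    (hFV : Disjoint F V) {q : A → A} (hq : Continuous q) (hq0 : q 0 = 0) (hqV : ∀ X, q X ∈ V) :
    ∀ᶠ X in 𝓝 (0 : A), expUnit 𝕜 (q X) ∈ H → q X = 0 := by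
  by_contra hcon
  obtain ⟨v, hv, hv'⟩ := exists_seq_forall_of_frequently (not_eventually.1 hcon)
  simp only [Classical.not_imp] at hv'
  have hu : Tendsto (fun k => q (v k)) atTop (𝓝 0) := by
    have := (hq.tendsto 0).comp hv
    rwa [hq0] at this
  have : ProperSpace A := FiniteDimensional.proper_rclike 𝕜 A
  have hsph : ∀ k, ((‖q (v k)‖⁻¹ : ℝ) : 𝕜) • q (v k) ∈ Metric.sphere (0 : A) 1 := fun k => by
    have := norm_pos_iff.2 (hv' k).2
    simp [norm_smul, this.ne']
  obtain ⟨Y, hY1, φ, hφ, hY⟩ := (isCompact_sphere (0 : A) 1).tendsto_subseq hsph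
  have hYF : Y ∈ F := (hF Y).2 fun t =>
    expUnit_smul_mem_of_tendsto hH (hu.comp hφ.tendsto_atTop) (fun k => (hv' (φ k)).2)
      (fun k => (hv' (φ k)).1) hY t
  have hYV : Y ∈ V := (Submodule.closed_of_finiteDimensional V).mem_of_tendsto hY
    (Eventually.of_forall fun k => V.smul_mem _ (hqV _))
  have : Y = 0 := Submodule.disjoint_def.1 hFV Y hYF hYV
  simp [this] at hY1

/-- **Closed subgroup theorem**: a closed subgroup of the group of invertible elements of a finite
dimensional algebra is an embedded submanifold, modelled on the space of the generators of its
one-parameter subgroups, provided that this real vector space is a subspace over `𝕜`. -/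
theorem isEmbeddedSubmanifold_of_isClosed {H : Subgroup Aˣ} (hH : IsClosed (H : Set Aˣ))
    {F : Submodule 𝕜 A} (hF : ∀ X, X ∈ F ↔ ∀ t : ℝ, expUnit 𝕜 ((t : 𝕜) • X) ∈ H) :
    IsEmbeddedSubmanifold ((fun T : Aˣ => (T : A)) '' (H : Set Aˣ)) F := by
  obtain ⟨V, hFV⟩ := F.exists_isCompl
  set p : A →L[𝕜] A := LinearMap.toContinuousLinearMap (F.projection V hFV) with hp
  set q : A →L[𝕜] A := LinearMap.toContinuousLinearMap (V.projection F hFV.symm) with hq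
  have hpF : ∀ X, p X ∈ F := fun X => by simp [hp]
  have hqV : ∀ X, q X ∈ V := fun X => by simp [hq]
  have hpq : ∀ X, p X + q X = X := fun X => by
    exact Submodule.projection_add_projection_eq_self hFV X
  have hq0 : ∀ X, q X = 0 ↔ X ∈ F := fun X => by
    simp [hq]
  -- The map `X ↦ exp (p X) * exp (q X)` is a local chart of the algebra at `1`.
  set Φ : A → A := fun X => NormedSpace.exp (p X) * NormedSpace.exp (q X) with hΦ
  have hΦ0 : Φ 0 = 1 := by simp [hΦ]
  have hΦs : ∀ {m : WithTop ℕ∞}, ContDiff 𝕜 m Φ := fun {m} =>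
    ((contDiff_exp 𝕜).comp p.contDiff).mul ((contDiff_exp 𝕜).comp q.contDiff)
  have hexp : ∀ L : A →L[𝕜] A, HasFDerivAt (fun X => NormedSpace.exp (L X)) L 0 := fun L => by
    have h0 : HasFDerivAt (NormedSpace.exp : A → A) (1 : A →L[𝕜] A) (L 0) := by
      rw [map_zero]; exact hasStrictFDerivAt_exp_zero.hasFDerivAt
    exact h0.comp 0 L.hasFDerivAt
  have hΦ' : HasFDerivAt Φ (ContinuousLinearEquiv.refl 𝕜 A : A →L[𝕜] A) 0 := by
    refine ((hexp p).mul' (hexp q)).congr_fderiv ?_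
    ext X
    simpa [add_comm] using hpq X
  set e : OpenPartialHomeomorph A A :=
    (hΦs (m := ω)).contDiffAt.toOpenPartialHomeomorph Φ hΦ' (by simp) with he
  have he_coe : (e : A → A) = Φ := ContDiffAt.toOpenPartialHomeomorph_coe _ _ _
  have he0 : (0 : A) ∈ e.source := ContDiffAt.mem_toOpenPartialHomeomorph_source _ _ _
  have he1 : (1 : A) ∈ e.target := by
    rw [← hΦ0, ← he_coe]; exact e.map_source he0
  have hes1 : e.symm 1 = 0 := by
    rw [← hΦ0, ← he_coe]; exact e.left_inv he0
  have hsymm : ContDiffAt 𝕜 ω e.symm 1 :=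
    e.contDiffAt_symm (f₀' := ContinuousLinearEquiv.refl 𝕜 A) he1
      (by rw [hes1, he_coe]; exact hΦ') (by rw [he_coe]; exact hΦs.contDiffAt)
  have hsymm' : ∀ᶠ y in 𝓝 (1 : A), ContDiffAt 𝕜 ∞ e.symm y := by
    filter_upwards [hsymm.eventually (by decide)] with y hy
    exact hy.of_le le_top
  have hev : ∀ᶠ X in 𝓝 (0 : A), ContDiffAt 𝕜 ∞ e.symm (Φ X) ∧
      (expUnit 𝕜 (q X) ∈ H → q X = 0) := by
    refine Eventually.and ?_ (eventually_eq_zero_of_exp_mem hH hF hFV.disjoint q.continuous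
      (map_zero q) hqV)
    refine (hΦs (m := 0)).continuous.continuousAt.eventually ?_
    rwa [hΦ0]
  set s : Set A := {X | ContDiffAt 𝕜 ∞ e.symm (Φ X) ∧ (expUnit 𝕜 (q X) ∈ H → q X = 0)} with hs
  have hs0 : (0 : A) ∈ interior s := mem_interior_iff_mem_nhds.2 hev
  have hone : ∀ X ∈ F, expUnit 𝕜 X ∈ H := fun X hX => by simpa using (hF X).1 hX 1
  have hmem : ∀ X ∈ s, (∃ T ∈ H, (T : A) = Φ X) ↔ X ∈ F := by
    intro X hX
    have hval : Φ X = ((expUnit 𝕜 (p X) * expUnit 𝕜 (q X) : Aˣ) : A) := rfl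
    constructor
    · rintro ⟨T, hT, hTX⟩
      rw [hval, Units.val_inj] at hTX
      refine (hq0 X).1 (hX.2 ?_)
      rw [hTX] at hT
      exact (H.mul_mem_cancel_left (hone _ (hpF X))).1 hT
    · intro hXF
      refine ⟨_, H.mul_mem (hone _ (hpF X)) (hone _ ?_), hval.symm⟩
      rw [(hq0 X).2 hXF]; exact F.zero_mem
  rintro _ ⟨x, hx, rfl⟩
  set g : A ≃ₜ A := Homeomorph.smul x⁻¹ with hg
  have hgy : ∀ y, g y = (x⁻¹ : Aˣ) * y := fun y => rfl
  have hgsy : ∀ y, g.symm y = x * y := fun y => by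
    rw [Homeomorph.symm_apply_eq, hgy]; simp
  have hmemφ : ∀ y, g y ∈ ((e.restr s).symm).source →
      e.symm (g y) ∈ s ∧ g y ∈ e.target ∧ Φ (e.symm (g y)) = g y := by
    intro y hy
    have h1 : g y ∈ e.target ∧ e.symm (g y) ∈ interior s := by
      simpa using hy
    exact ⟨interior_subset h1.2, h1.1, by rw [← he_coe]; exact e.right_inv h1.1⟩
  refine ⟨g.transOpenPartialHomeomorph (e.restr s).symm, ?_, ?_, ?_, ?_⟩
  · have : g x = 1 := by simp [hgy]
    simp [this, he1, hes1, hs0]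
  · intro y hy
    have h1 := hmemφ y (by simpa using hy)
    have h2 := h1.1.1
    rw [h1.2.2] at h2
    refine (ContDiffAt.comp y (g := e.symm) (f := g) h2 ?_).contDiffWithinAt
    exact contDiffAt_const.mul contDiffAt_id
  · intro y hy
    have : ContDiff 𝕜 ∞ (fun y => (x : A) * Φ y) := contDiff_const.mul hΦs
    refine (this.contDiffAt.congr_of_eventuallyEq (Eventually.of_forall fun z => ?_)).contDiffWithinAt
    change g.symm (e z) = x * Φ z
    rw [hgsy, he_coe]
  · intro y hy
    have h1 := hmemφ y (by simpa using hy)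
    change _ ↔ e.symm (g y) ∈ F
    rw [← hmem _ h1.1, h1.2.2, hgy]
    constructor
    · rintro ⟨T, hT, rfl⟩
      exact ⟨x⁻¹ * T, H.mul_mem (H.inv_mem hx) hT, by simp⟩
    · rintro ⟨T, hT, hTy⟩
      exact ⟨x * T, H.mul_mem hx hT, by simp [hTy]⟩

end ClosedSubgroup

/-! ### Groups defined by automorphisms and anti-automorphisms -/

section NormGroups

variable {𝕜 A : Type*} [RCLike 𝕜] [NormedRing A] [NormedAlgebra 𝕜 A]

/-- The subspace of the elements `X` for which `θ X - X` is central. -/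
def twistLie (θ : A →ₐ[𝕜] A) : Submodule 𝕜 A :=
  (Subalgebra.toSubmodule (Subalgebra.center 𝕜 A)).comap (θ.toLinearMap - LinearMap.id)

theorem mem_twistLie {θ : A →ₐ[𝕜] A} {X : A} :
    X ∈ twistLie θ ↔ θ X - X ∈ Subalgebra.center 𝕜 A := Iff.rfl

/-- The subspace of the elements `X` of `L` for which `τ X + X` lies in `K`. -/
def normLie (τ : A →ₗ[𝕜] A) (K : Subalgebra 𝕜 A) (L : Submodule 𝕜 A) : Submodule 𝕜 A :=
  L ⊓ (Subalgebra.toSubmodule K).comap (τ + LinearMap.id)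

theorem mem_normLie {τ : A →ₗ[𝕜] A} {K : Subalgebra 𝕜 A} {L : Submodule 𝕜 A} {X : A} :
    X ∈ normLie τ K L ↔ X ∈ L ∧ τ X + X ∈ K := Iff.rfl

variable [CompleteSpace A] in
/-- `H` is closed in the group of invertible elements, and the subspace `F` is its Lie algebra: it
is closed under commutators and consists of the generators of the one-parameter subgroups that stay
in `H`. -/
structure IsClosedWithLieAlgebra (H : Subgroup Aˣ) (F : Submodule 𝕜 A) : Prop where
  isClosed : IsClosed (H : Set Aˣ)
  commutator_mem : ∀ X ∈ F, ∀ Y ∈ F, X * Y - Y * X ∈ F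
  mem_iff : ∀ X, X ∈ F ↔ ∀ t : ℝ, expUnit 𝕜 ((t : 𝕜) • X) ∈ H

variable [CompleteSpace A] in
theorem isClosedWithLieAlgebra_top :
    IsClosedWithLieAlgebra (⊤ : Subgroup Aˣ) (⊤ : Submodule 𝕜 A) where
  isClosed := isClosed_univ
  commutator_mem := by simp
  mem_iff := by simp

/-- A tangent vector at `0` of a curve that stays in a subspace for real values of the parameter
lies in that subspace. -/
theorem mem_of_hasDerivAt_zero [FiniteDimensional 𝕜 A] {K : Submodule 𝕜 A} {f : 𝕜 → A} {f' : A}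
    (hf : HasDerivAt f f' 0) (hK : ∀ t : ℝ, f t ∈ K) : f' ∈ K := by
  have hs : Tendsto (fun k : ℕ => (1 / ((k : 𝕜) + 1))) atTop (𝓝[≠] 0) := by
    refine tendsto_nhdsWithin_iff.2 ⟨?_, Eventually.of_forall fun k => ?_⟩
    · have h := (RCLike.continuous_ofReal (K := 𝕜)).tendsto 0 |>.comp
        (tendsto_one_div_add_atTop_nhds_zero_nat (𝕜 := ℝ))
      simpa [Function.comp_def] using h
    · exact one_div_ne_zero (Nat.cast_add_one_ne_zero k)
  refine (Submodule.closed_of_finiteDimensional K).mem_of_tendsto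
    (hf.tendsto_slope_zero.comp hs) (Eventually.of_forall fun k => ?_)
  refine K.smul_mem _ (K.sub_mem ?_ ?_)
  · simpa using hK (1 / ((k : ℝ) + 1))
  · simpa using hK 0

variable [FiniteDimensional 𝕜 A]

/-- In a finite dimensional algebra, a subalgebra contains the inverses of its elements. -/
theorem inv_mem_of_mem (K : Subalgebra 𝕜 A) {u : Aˣ} (hu : (u : A) ∈ K) : ((u⁻¹ : Aˣ) : A) ∈ K := by
  have hinj : Function.Injective (LinearMap.mulLeft 𝕜 (⟨u, hu⟩ : K)) := fun x y hxy => by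
    have : (u : A) * x = u * y := congrArg Subtype.val hxy
    exact Subtype.ext (u.isUnit.mul_left_cancel this)
  obtain ⟨v, hv⟩ := LinearMap.surjective_of_injective hinj 1
  have hv' : (u : A) * v = 1 := congrArg Subtype.val hv
  rw [Units.inv_eq_of_mul_eq_one_right hv']
  exact v.2

/-- The group of the invertible elements `T` for which `θ T = z * T` with `z` central. -/
def twistGroup (θ : A →ₐ[𝕜] A) : Subgroup Aˣ where
  carrier := {T : Aˣ | θ (T : A) * (T⁻¹ : Aˣ) ∈ Subalgebra.center 𝕜 A}
  one_mem' := by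
    change θ ((1 : Aˣ) : A) * ((1⁻¹ : Aˣ) : A) ∈ Subalgebra.center 𝕜 A
    simp
  mul_mem' := by
    intro T S hT hS
    have h : θ (T * S : Aˣ) * ((T * S)⁻¹ : Aˣ) = (θ S * (S⁻¹ : Aˣ)) * (θ T * (T⁻¹ : Aˣ)) := by
      have h1 := (Subalgebra.mem_center_iff (R := 𝕜)).1 hS (θ T)
      calc θ (T * S : Aˣ) * ((T * S)⁻¹ : Aˣ) = (θ T * (θ S * (S⁻¹ : Aˣ))) * (T⁻¹ : Aˣ) := by
            simp [mul_assoc]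
        _ = _ := by rw [h1, mul_assoc]
    change _ ∈ Subalgebra.center 𝕜 A
    rw [h]
    exact mul_mem hS hT
  inv_mem' := by
    intro T hT
    have h : ((Units.map (θ : A →* A) T * T⁻¹)⁻¹ : Aˣ) = θ (T⁻¹ : Aˣ) * ((T⁻¹)⁻¹ : Aˣ) := by
      have h1 : θ (T⁻¹ : Aˣ) * (θ T * (T⁻¹ : Aˣ)) = θ T * (T⁻¹ : Aˣ) * θ (T⁻¹ : Aˣ) :=
        (Subalgebra.mem_center_iff (R := 𝕜)).1 hT (θ (T⁻¹ : Aˣ))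
      apply Units.inv_eq_of_mul_eq_one_right
      change θ T * (T⁻¹ : Aˣ) * (θ (T⁻¹ : Aˣ) * ((T⁻¹)⁻¹ : Aˣ)) = 1
      rw [← mul_assoc, ← h1, ← mul_assoc, ← map_mul]
      simp
    change _ ∈ Subalgebra.center 𝕜 A
    rw [← h]
    exact inv_mem_of_mem _ hT

theorem mem_twistGroup {θ : A →ₐ[𝕜] A} {T : Aˣ} :
    T ∈ twistGroup θ ↔ θ T * (T⁻¹ : Aˣ) ∈ Subalgebra.center 𝕜 A := Iff.rfl

/-- The group of the `T` in `P` for which `τ T * T` lies in `K`, where `τ` is an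
anti-endomorphism and `P` normalizes the subalgebra `K`. -/
def normGroup (τ : A →ₗ[𝕜] A) (hτ1 : τ 1 = 1) (hτ : ∀ x y, τ (x * y) = τ y * τ x)
    (K : Subalgebra 𝕜 A) (P : Subgroup Aˣ)
    (hPK : ∀ T ∈ P, ∀ k ∈ K, (T : A) * k * (T⁻¹ : Aˣ) ∈ K) : Subgroup Aˣ where
  carrier := {T | T ∈ P ∧ τ T * T ∈ K}
  one_mem' := ⟨P.one_mem, by rw [Units.val_one, hτ1, mul_one]; exact K.one_mem⟩
  mul_mem' := by
    rintro T S ⟨hT, hT'⟩ ⟨hS, hS'⟩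
    refine ⟨P.mul_mem hT hS, ?_⟩
    have h1 := hPK _ (P.inv_mem hS) _ hT'
    rw [inv_inv] at h1
    have h2 : τ (T * S : Aˣ) * (T * S : Aˣ) =
        (τ S * S) * ((S⁻¹ : Aˣ) * (τ T * T) * S) := by
      rw [Units.val_mul, hτ]
      simp [mul_assoc]
    rw [h2]
    exact K.mul_mem hS' h1
  inv_mem' := by
    rintro T ⟨hT, hT'⟩
    refine ⟨P.inv_mem hT, ?_⟩
    have h0 : τ (T⁻¹ : Aˣ) * τ T = 1 := by rw [← hτ]; simp [hτ1]
    have h0' : τ T * τ (T⁻¹ : Aˣ) = 1 := by rw [← hτ]; simp [hτ1]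
    have h1 : (T : A) * τ T ∈ K := by
      have := hPK T hT _ hT'
      rwa [mul_assoc, mul_assoc, Units.mul_inv, mul_one] at this
    let u : Aˣ := ⟨T * τ T, τ (T⁻¹ : Aˣ) * (T⁻¹ : Aˣ),
      by rw [mul_assoc, ← mul_assoc (τ T), h0', one_mul, Units.mul_inv],
      by rw [mul_assoc, ← mul_assoc _ (T : A), Units.inv_mul, one_mul, h0]⟩
    exact inv_mem_of_mem K (u := u) h1

theorem mem_normGroup {τ : A →ₗ[𝕜] A} {hτ1 : τ 1 = 1} {hτ : ∀ x y, τ (x * y) = τ y * τ x}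
    {K : Subalgebra 𝕜 A} {P : Subgroup Aˣ}
    {hPK : ∀ T ∈ P, ∀ k ∈ K, (T : A) * k * (T⁻¹ : Aˣ) ∈ K} {T : Aˣ} :
    T ∈ normGroup τ hτ1 hτ K P hPK ↔ T ∈ P ∧ τ T * T ∈ K := Iff.rfl

variable [CompleteSpace A]

theorem exp_mem_subalgebra (K : Subalgebra 𝕜 A) {x : A} (hx : x ∈ K) : NormedSpace.exp x ∈ K :=
  (Submodule.closed_of_finiteDimensional (Subalgebra.toSubmodule K)).mem_of_tendsto
    (NormedSpace.exp_series_hasSum_exp' (𝕂 := 𝕜) x)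
    (Eventually.of_forall fun _ => Submodule.sum_mem _ fun k _ => K.smul_mem (K.pow_mem hx k) _)

/-- The exponential commutes with linear maps that preserve powers, such as automorphisms and
anti-automorphisms. -/
theorem map_exp_of_map_pow (f : A →ₗ[𝕜] A) (hf : ∀ x k, f (x ^ k) = f x ^ k) (x : A) :
    f (NormedSpace.exp x) = NormedSpace.exp (f x) := by
  have h := (LinearMap.toContinuousLinearMap f).hasSum
    (NormedSpace.exp_series_hasSum_exp' (𝕂 := 𝕜) x)
  refine h.unique ?_
  simpa [hf] using NormedSpace.exp_series_hasSum_exp' (𝕂 := 𝕜) (f x)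

/-- Derivative at `t = 0` of `θ (exp (t X)) * exp (- t X)` in one direction; in the other one, if
`θ X = X + z` with `z` central, this product is `exp (t z)`. -/
theorem isClosedWithLieAlgebra_twist (θ : A →ₐ[𝕜] A) :
    IsClosedWithLieAlgebra (twistGroup θ) (twistLie θ) where
  isClosed := by
    have hθ : Continuous θ := θ.toLinearMap.continuous_of_finiteDimensional
    have h : Continuous fun T : Aˣ => θ T * (T⁻¹ : Aˣ) :=
      (hθ.comp Units.continuous_val).mul (Units.continuous_val.comp continuous_inv)
    exact (Submodule.closed_of_finiteDimensional
      (Subalgebra.toSubmodule (Subalgebra.center 𝕜 A))).preimage h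
  commutator_mem := by
    intro X hX Y hY
    obtain ⟨z, hz, hX⟩ : ∃ z ∈ Subalgebra.center 𝕜 A, θ X = X + z := ⟨_, hX, (add_sub_cancel _ _).symm⟩
    obtain ⟨w, hw, hY⟩ : ∃ w ∈ Subalgebra.center 𝕜 A, θ Y = Y + w := ⟨_, hY, (add_sub_cancel _ _).symm⟩
    have h : θ (X * Y - Y * X) - (X * Y - Y * X) = 0 := by
      have h1 := Subalgebra.mem_center_iff.1 hz
      have h2 := Subalgebra.mem_center_iff.1 hw
      simp only [map_sub, map_mul, hX, hY, add_mul, mul_add, h1 Y, h2 X, h1 w]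
      abel
    rw [mem_twistLie, h]
    exact zero_mem _
  mem_iff := by
    intro X
    have hexp : ∀ Y, θ (NormedSpace.exp Y) = NormedSpace.exp (θ Y) :=
      map_exp_of_map_pow θ.toLinearMap (map_pow θ)
    have hval : ∀ t : ℝ, θ (expUnit 𝕜 ((t : 𝕜) • X)) * ((expUnit 𝕜 ((t : 𝕜) • X))⁻¹ : Aˣ) =
        θ (NormedSpace.exp ((t : 𝕜) • X)) * NormedSpace.exp ((t : 𝕜) • -X) := fun t => by
      rw [val_inv_expUnit, val_expUnit, val_expUnit, smul_neg]
    simp only [mem_twistGroup, mem_twistLie, hval]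
    constructor
    · intro hX t
      obtain ⟨z, hz, hX⟩ : ∃ z ∈ Subalgebra.center 𝕜 A, θ X = X + z := ⟨_, hX, (add_sub_cancel _ _).symm⟩
      have hc : Commute (θ ((t : 𝕜) • X)) ((t : 𝕜) • -X) := by
        rw [map_smul, hX]
        exact (((Commute.refl X).add_left
          (Subalgebra.mem_center_iff.1 hz X).symm).neg_right.smul_left _).smul_right _
      rw [hexp, ← exp_add_of_commute' 𝕜 hc, map_smul, ← smul_add, hX]
      refine exp_mem_subalgebra _ (Subalgebra.smul_mem _ ?_ _)
      simpa using hz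
    · intro h
      have h1 : HasDerivAt (fun u : 𝕜 => NormedSpace.exp (u • X)) X 0 := by
        simpa using hasDerivAt_exp_smul_const X (0 : 𝕜)
      have h2 : HasDerivAt (fun u : 𝕜 => NormedSpace.exp (u • -X)) (-X) 0 := by
        simpa using hasDerivAt_exp_smul_const (-X) (0 : 𝕜)
      have h3 : HasDerivAt (fun u : 𝕜 => θ (NormedSpace.exp (u • X))) (θ X) 0 :=
        (LinearMap.toContinuousLinearMap θ.toLinearMap).hasFDerivAt.comp_hasDerivAt 0 h1
      have h4 := mem_of_hasDerivAt_zero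
        (K := Subalgebra.toSubmodule (Subalgebra.center 𝕜 A)) (h3.mul h2) h
      simpa [sub_eq_add_neg] using h4

/-- Derivative at `t = 0` of `τ (exp (t X)) * exp (t X)` in one direction; in the other one, if
`τ X = z - X` with `z` commuting with `X`, this product is `exp (t z)`. -/
theorem isClosedWithLieAlgebra_norm {τ : A →ₗ[𝕜] A} (hτ1 : τ 1 = 1)
    (hτ : ∀ x y, τ (x * y) = τ y * τ x) {K : Subalgebra 𝕜 A} {P : Subgroup Aˣ}
    (hPK : ∀ T ∈ P, ∀ k ∈ K, (T : A) * k * (T⁻¹ : Aˣ) ∈ K) {L : Submodule 𝕜 A}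
    (hP : IsClosedWithLieAlgebra P L) (hLK : ∀ X ∈ L, ∀ k ∈ K, Commute X k) :
    IsClosedWithLieAlgebra (normGroup τ hτ1 hτ K P hPK) (normLie τ K L) where
  isClosed := by
    have hτc : Continuous τ := τ.continuous_of_finiteDimensional
    have h : Continuous fun T : Aˣ => τ T * (T : A) :=
      (hτc.comp Units.continuous_val).mul Units.continuous_val
    exact hP.isClosed.inter ((Submodule.closed_of_finiteDimensional
      (Subalgebra.toSubmodule K)).preimage h)
  commutator_mem := by
    rintro X ⟨hXL, hX⟩ Y ⟨hYL, hY⟩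
    refine ⟨hP.commutator_mem X hXL Y hYL, ?_⟩
    obtain ⟨z, hz, hX⟩ : ∃ z ∈ K, τ X = z - X := ⟨_, hX, (add_sub_cancel_right _ _).symm⟩
    obtain ⟨w, hw, hY⟩ : ∃ w ∈ K, τ Y = w - Y := ⟨_, hY, (add_sub_cancel_right _ _).symm⟩
    have h : τ (X * Y - Y * X) + (X * Y - Y * X) = w * z - z * w := by
      rw [map_sub, hτ, hτ, hX, hY]
      simp only [sub_mul, mul_sub, (hLK X hXL w hw).eq, (hLK Y hYL z hz).eq]
      abel
    change τ (X * Y - Y * X) + (X * Y - Y * X) ∈ K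
    rw [h]
    exact K.sub_mem (K.mul_mem hw hz) (K.mul_mem hz hw)
  mem_iff := by
    intro X
    have hpow : ∀ x k, τ (x ^ k) = τ x ^ k := fun x k => by
      induction k with
      | zero => simp [hτ1]
      | succ k ih => rw [pow_succ, hτ, ih, pow_succ']
    change X ∈ L ∧ τ X + X ∈ K ↔ ∀ t : ℝ, expUnit 𝕜 ((t : 𝕜) • X) ∈ P ∧
      τ (NormedSpace.exp ((t : 𝕜) • X)) * NormedSpace.exp ((t : 𝕜) • X) ∈ K
    rw [forall_and, ← hP.mem_iff]
    refine and_congr_right fun hXL => ⟨fun hX t => ?_, fun h => ?_⟩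
    · obtain ⟨z, hz, hX⟩ : ∃ z ∈ K, τ X = z - X := ⟨_, hX, (add_sub_cancel_right _ _).symm⟩
      have hc : Commute (τ ((t : 𝕜) • X)) ((t : 𝕜) • X) := by
        rw [map_smul, hX]
        exact (((hLK X hXL z hz).symm.sub_left (Commute.refl X)).smul_left _).smul_right _
      rw [map_exp_of_map_pow τ hpow, ← exp_add_of_commute' 𝕜 hc, map_smul, ← smul_add, hX,
        sub_add_cancel]
      exact exp_mem_subalgebra _ (Subalgebra.smul_mem _ hz _)
    · have h1 : HasDerivAt (fun u : 𝕜 => NormedSpace.exp (u • X)) X 0 := by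
        simpa using hasDerivAt_exp_smul_const X (0 : 𝕜)
      have h3 : HasDerivAt (fun u : 𝕜 => τ (NormedSpace.exp (u • X))) (τ X) 0 :=
        (LinearMap.toContinuousLinearMap τ).hasFDerivAt.comp_hasDerivAt 0 h1
      have h4 := mem_of_hasDerivAt_zero (K := Subalgebra.toSubmodule K) (h3.mul h1) h
      simpa [hτ1] using h4

end NormGroups

/-! ### The basis of monomials -/

section Monomials

variable {𝕜 : Type*} [RCLike 𝕜] {n : ℕ} (η : Fin n → 𝕜)

theorem e_mul_self (a : Fin n) : e η a * e η a = η a • 1 := by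
  rw [e, CliffordAlgebra.ι_sq_scalar, Algebra.algebraMap_eq_smul_one,
    QuadraticMap.weightedSumSquares_apply]
  simp [Pi.single_apply]

theorem e_mul_e_of_ne {a b : Fin n} (h : a ≠ b) : e η a * e η b = -(e η b * e η a) := by
  refine CliffordAlgebra.ι_mul_ι_comm_of_isOrtho ?_
  rw [QuadraticMap.isOrtho_def]
  simp only [QuadraticMap.weightedSumSquares_apply, ← Finset.sum_add_distrib]
  refine Finset.sum_congr rfl fun i _ => ?_
  by_cases ha : i = a
  · subst ha; simp [h]
  · simp [ha]

@[simp] theorem eProd_empty : eProd η ∅ = 1 := by simp [eProd]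

theorem eProd_insert {a : Fin n} {s : Finset (Fin n)} (h : ∀ x ∈ s, a < x) :
    eProd η (insert a s) = e η a * eProd η s := by
  rw [eProd, Finset.sort_insert _ (fun b hb => (h b hb).le) (fun ha => (h a ha).false)]
  simp [eProd]

theorem eProd_mul_e (a : Fin n) (s : Finset (Fin n)) :
    eProd η s * e η a = (-1 : 𝕜) ^ (s.card + if a ∈ s then 1 else 0) • (e η a * eProd η s) := by
  induction s using Finset.induction_on_min with
  | empty => simp
  | insert b s hb ih =>
    have hbs : b ∉ s := fun h => (hb b h).false
    rw [eProd_insert η hb, mul_assoc, ih, Finset.card_insert_of_notMem hbs]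
    by_cases hab : a = b
    · subst hab
      simp [hbs, pow_succ]
    · rw [mul_smul_comm, ← mul_assoc, e_mul_e_of_ne η (Ne.symm hab)]
      simp only [Finset.mem_insert, hab, false_or, neg_mul, smul_neg, mul_assoc]
      rw [add_right_comm, pow_succ]
      simp

/-- Up to a scalar, left multiplication by a generator permutes the monomials. -/
theorem exists_e_mul_eProd (a : Fin n) (s : Finset (Fin n)) :
    ∃ c : 𝕜, e η a * eProd η s = c • eProd η (symmDiff {a} s) := by
  induction s using Finset.induction_on_min with
  | empty =>
    refine ⟨1, ?_⟩
    have := eProd_insert η (a := a) (s := ∅) (by simp)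
    rw [show symmDiff {a} (∅ : Finset (Fin n)) = {a} from symmDiff_bot _]
    simpa using this.symm
  | insert b s hb ih =>
    have hbs : b ∉ s := fun h => (hb b h).false
    rcases lt_trichotomy a b with hab | rfl | hab
    · refine ⟨1, ?_⟩
      have h1 : ∀ x ∈ insert b s, a < x := by
        intro x hx
        rcases Finset.mem_insert.1 hx with rfl | hx
        · exact hab
        · exact hab.trans (hb x hx)
      have h2 : symmDiff {a} (insert b s) = insert a (insert b s) := by
        have : a ∉ insert b s := fun h => (h1 a h).false
        ext x
        simp only [Finset.mem_symmDiff, Finset.mem_singleton, Finset.mem_insert] at *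
        grind
      rw [h2, eProd_insert η h1, one_smul]
    · refine ⟨η a, ?_⟩
      have h2 : symmDiff {a} (insert a s) = s := by
        ext x
        simp only [Finset.mem_symmDiff, Finset.mem_singleton, Finset.mem_insert]
        grind
      rw [h2, eProd_insert η hb, ← mul_assoc, e_mul_self, smul_mul_assoc, one_mul]
    · obtain ⟨c, hc⟩ := ih
      refine ⟨-c, ?_⟩
      have h1 : ∀ x ∈ symmDiff {a} s, b < x := by
        intro x hx
        rw [Finset.mem_symmDiff, Finset.mem_singleton] at hx
        rcases hx with hx | hx
        · rw [hx.1]; exact hab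
        · exact hb x hx.1
      have h2 : symmDiff {a} (insert b s) = insert b (symmDiff {a} s) := by
        have := hab.ne
        ext x
        simp only [Finset.mem_symmDiff, Finset.mem_singleton, Finset.mem_insert]
        grind
      rw [h2, eProd_insert η h1, eProd_insert η hb, ← mul_assoc, e_mul_e_of_ne η hab.ne', neg_mul,
        mul_assoc, hc, mul_smul_comm, neg_smul]

theorem ι_eq_sum (v : Fin n → 𝕜) : CliffordAlgebra.ι (quadForm η) v = ∑ a, v a • e η a := by
  conv_lhs => rw [← (Pi.basisFun 𝕜 (Fin n)).sum_repr v]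
  simp [e]

theorem span_range_eProd : Submodule.span 𝕜 (Set.range (eProd η)) = ⊤ := by
  rw [eq_top_iff]
  rintro x -
  induction x using CliffordAlgebra.left_induction with
  | algebraMap r =>
    rw [Algebra.algebraMap_eq_smul_one]
    exact Submodule.smul_mem _ _ (Submodule.subset_span ⟨∅, eProd_empty η⟩)
  | add x y hx hy => exact Submodule.add_mem _ hx hy
  | ι_mul x m hx =>
    rw [ι_eq_sum, Finset.sum_mul]
    refine Submodule.sum_mem _ fun a _ => ?_
    rw [smul_mul_assoc]
    refine Submodule.smul_mem _ _ ?_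
    induction hx using Submodule.span_induction with
    | mem x hx =>
      obtain ⟨s, rfl⟩ := hx
      obtain ⟨c, hc⟩ := exists_e_mul_eProd η a s
      rw [hc]
      exact Submodule.smul_mem _ _ (Submodule.subset_span ⟨_, rfl⟩)
    | zero => simp
    | add x y _ _ hx hy => rw [mul_add]; exact Submodule.add_mem _ hx hy
    | smul c x _ hx => rw [mul_smul_comm]; exact Submodule.smul_mem _ _ hx

/-- The basis of the ordered monomials in the generators. They span, and there are as many of them
as the dimension `2 ^ n`, which is known from the exterior algebra. -/
def eBasis : Module.Basis (Finset (Fin n)) 𝕜 (Cl η) :=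
  basisOfTopLeSpanOfCardEqFinrank (eProd η) (span_range_eProd η).ge
    (Module.finrank_eq_card_basis (clBasis η)).symm

@[simp] theorem eBasis_apply (s : Finset (Fin n)) : eBasis η s = eProd η s := by
  simp [eBasis]

@[simp] theorem repr_eProd (s : Finset (Fin n)) :
    (eBasis η).repr (eProd η s) = Finsupp.single s 1 := by
  rw [← eBasis_apply, Module.Basis.repr_self]

/-! ### Sums of the subspaces of given grades -/

/-- The sum of the subspaces of the grades that belong to `S`. -/
def gradeSet (S : Set ℕ) : Submodule 𝕜 (Cl η) :=
  Submodule.span 𝕜 (eBasis η '' {s | s.card ∈ S})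

variable {η}

theorem mem_gradeSet {S : Set ℕ} {x : Cl η} :
    x ∈ gradeSet η S ↔ ∀ s, (eBasis η).repr x s ≠ 0 → s.card ∈ S := by
  rw [gradeSet, Module.Basis.mem_span_image]
  simp [Set.subset_def]

theorem eProd_mem_gradeSet {S : Set ℕ} {s : Finset (Fin n)} :
    eProd η s ∈ gradeSet η S ↔ s.card ∈ S := by
  rw [mem_gradeSet, repr_eProd]
  simp [Finsupp.single_apply]

theorem gradeSet_le_iff {S T : Set ℕ} :
    gradeSet η S ≤ gradeSet η T ↔ ∀ k ≤ n, k ∈ S → k ∈ T := by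
  constructor
  · intro h k hk hkS
    obtain ⟨s, -, hs⟩ := Finset.exists_subset_card_eq (s := (Finset.univ : Finset (Fin n)))
      (n := k) (by simpa using hk)
    have := @h (eProd η s) (eProd_mem_gradeSet.2 (by rwa [hs]))
    rwa [eProd_mem_gradeSet, hs] at this
  · intro h x hx
    rw [mem_gradeSet] at hx ⊢
    exact fun s hs => h _ (by simpa using s.card_le_univ) (hx s hs)

theorem gradeSet_eq_iff {S T : Set ℕ} :
    gradeSet η S = gradeSet η T ↔ ∀ k ≤ n, k ∈ S ↔ k ∈ T := by
  rw [le_antisymm_iff, gradeSet_le_iff, gradeSet_le_iff]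
  exact ⟨fun h k hk => ⟨h.1 k hk, h.2 k hk⟩, fun h => ⟨fun k hk => (h k hk).1, fun k hk => (h k hk).2⟩⟩

theorem gradeSet_sup (S T : Set ℕ) : gradeSet η S ⊔ gradeSet η T = gradeSet η (S ∪ T) := by
  rw [gradeSet, gradeSet, gradeSet, ← Submodule.span_union, ← Set.image_union]
  rfl

theorem gradeSet_inf (S T : Set ℕ) : gradeSet η S ⊓ gradeSet η T = gradeSet η (S ∩ T) := by
  ext x
  simp only [Submodule.mem_inf, mem_gradeSet, Set.mem_inter_iff]
  grind

theorem grade_eq (k : ℕ) : grade η k = gradeSet η {k} := by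
  rw [grade, gradeSet]
  congr 1
  ext x
  simp [eq_comm]

theorem iSup_grade_eq (p : ℕ → Prop) : ⨆ k, ⨆ _ : p k, grade η k = gradeSet η {k | p k} := by
  apply le_antisymm
  · refine iSup₂_le fun k hk => ?_
    rw [grade_eq, gradeSet_le_iff]
    rintro j - rfl
    exact hk
  · refine Submodule.span_le.2 ?_
    rintro _ ⟨s, hs, rfl⟩
    refine Submodule.mem_iSup_of_mem s.card (Submodule.mem_iSup_of_mem hs ?_)
    exact Submodule.subset_span ⟨s, rfl, eBasis_apply η s⟩

theorem parity_eq (j : ℕ) : parity η j = gradeSet η {k | k % 2 = j} := iSup_grade_eq _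

theorem quat_eq (m : ℕ) : quat η m = gradeSet η {k | k % 4 = m} := iSup_grade_eq _

theorem finrank_gradeSet (S : Set ℕ) [DecidablePred (· ∈ S)] :
    Module.finrank 𝕜 (gradeSet η S) =
      ∑ k ∈ Finset.range (n + 1), if k ∈ S then n.choose k else 0 := by
  classical
  have h1 : gradeSet η S = Submodule.span 𝕜
      ((Finset.univ.filter fun s : Finset (Fin n) => s.card ∈ S).image (eBasis η) : Set (Cl η)) := by
    rw [gradeSet]; simp
  rw [h1, finrank_span_finset_eq_card, Finset.card_image_of_injective _ (eBasis η).injective,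
    Finset.card_filter, ← Finset.powerset_univ, Finset.sum_powerset_apply_card
      (fun k => if k ∈ S then 1 else 0)]
  · simp
  · rw [Finset.coe_image]
    exact (eBasis η).linearIndependent.linearIndepOn_id.mono (by
      rintro _ ⟨s, -, rfl⟩; exact ⟨s, rfl⟩)

theorem repr_of_diagonal {f : Cl η →ₗ[𝕜] Cl η} {d : ℕ → 𝕜}
    (hf : ∀ s, f (eProd η s) = d s.card • eProd η s) (x : Cl η) (s : Finset (Fin n)) :
    (eBasis η).repr (f x) s = d s.card * (eBasis η).repr x s := by
  have h : ((eBasis η).coord s) ∘ₗ f = d s.card • (eBasis η).coord s := by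
    refine (eBasis η).ext fun t => ?_
    simp only [LinearMap.comp_apply, eBasis_apply, hf, map_smul, LinearMap.smul_apply]
    by_cases hst : t = s
    · rw [hst]
    · simp [hst]
  exact LinearMap.congr_fun h x

/-- For a linear map that acts on each grade by a scalar, the preimage of a sum of grades is a sum
of grades. -/
theorem apply_mem_gradeSet_iff {f : Cl η →ₗ[𝕜] Cl η} {d : ℕ → 𝕜}
    (hf : ∀ s, f (eProd η s) = d s.card • eProd η s) {S : Set ℕ} {x : Cl η} :
    f x ∈ gradeSet η S ↔ x ∈ gradeSet η {k | d k = 0 ∨ k ∈ S} := by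
  simp only [mem_gradeSet, repr_of_diagonal hf, Set.mem_ofPred_eq, mul_ne_zero_iff]
  grind

/-! ### Involutions -/

theorem involute_eProd (s : Finset (Fin n)) :
    CliffordAlgebra.involute (eProd η s) = (-1 : 𝕜) ^ s.card • eProd η s := by
  induction s using Finset.induction_on_min with
  | empty => simp
  | insert b s hb ih =>
    have hbs : b ∉ s := fun h => (hb b h).false
    rw [eProd_insert η hb, map_mul, ih, Finset.card_insert_of_notMem hbs, e,
      CliffordAlgebra.involute_ι, pow_succ]
    simp

theorem reverse_eProd (s : Finset (Fin n)) :
    CliffordAlgebra.reverse (eProd η s) = (-1 : 𝕜) ^ (s.card.choose 2) • eProd η s := by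
  induction s using Finset.induction_on_min with
  | empty => simp
  | insert b s hb ih =>
    have hbs : b ∉ s := fun h => (hb b h).false
    have he : CliffordAlgebra.reverse (e η b) = e η b := CliffordAlgebra.reverse_ι _
    rw [eProd_insert η hb, CliffordAlgebra.reverse.map_mul, ih, he, smul_mul_assoc, eProd_mul_e,
      Finset.card_insert_of_notMem hbs, smul_smul, Nat.choose_succ_succ' s.card 1]
    simp [hbs, pow_add, mul_comm]

theorem neg_one_pow_choose_two (R : Type*) [Ring R] (k : ℕ) :
    (-1 : R) ^ (k.choose 2) = if k % 4 < 2 then 1 else -1 := by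
  induction k with
  | zero => simp
  | succ k ih =>
    rw [Nat.choose_succ_succ' k 1, Nat.choose_one_right, pow_add, ih]
    rcases Nat.even_or_odd k with hk | hk
    · rw [hk.neg_one_pow]
      rw [Nat.even_iff] at hk
      have : k % 4 < 2 ↔ (k + 1) % 4 < 2 := by omega
      simp [this]
    · rw [hk.neg_one_pow]
      rw [Nat.odd_iff] at hk
      have : k % 4 < 2 ↔ ¬ (k + 1) % 4 < 2 := by omega
      split_ifs <;> simp <;> grind

end Monomials

/-! ### The center -/

section Center

variable {𝕜 : Type*} [RCLike 𝕜] {n : ℕ} {η : Fin n → 𝕜}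

theorem commute_of_forall_e {x : Cl η} (h : ∀ a, e η a * x = x * e η a) (y : Cl η) :
    y * x = x * y := by
  induction y using CliffordAlgebra.induction with
  | algebraMap r => exact Algebra.commutes r x
  | ι v => simp only [ι_eq_sum, Finset.sum_mul, Finset.mul_sum, smul_mul_assoc, mul_smul_comm, h]
  | mul y z hy hz => rw [mul_assoc, hz, ← mul_assoc, hy, mul_assoc]
  | add y z hy hz => rw [add_mul, mul_add, hy, hz]

/-- The grades of the center of the Clifford algebra of an `n`-dimensional space. -/
def centerGrades (n : ℕ) : Set ℕ := {k | k = 0 ∨ (k = n ∧ n % 2 = 1)}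

@[simp] theorem mem_centerGrades {n k : ℕ} :
    k ∈ centerGrades n ↔ k = 0 ∨ (k = n ∧ n % 2 = 1) := Iff.rfl

/-- Comparing coefficients in `x * e a = e a * x`: a monomial that occurs in a central element has
an even number of factors other than `e a`, for every `a`; so its set of factors is empty or
everything. -/
theorem center_eq (hη : ∀ a, η a = 1 ∨ η a = -1) : center η = gradeSet η (centerGrades n) := by
  apply le_antisymm
  · intro x hx
    rw [mem_gradeSet]
    intro s hs
    have hsum := (eBasis η).sum_repr x
    simp only [eBasis_apply] at hsum
    have key : ∀ a, (-1 : 𝕜) ^ (s.card + if a ∈ s then 1 else 0) = 1 := by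
      intro a
      have h1 : x * e η a = e η a * ∑ t, ((eBasis η).repr x t *
          (-1 : 𝕜) ^ (t.card + if a ∈ t then 1 else 0)) • eBasis η t := by
        conv_lhs => rw [← hsum, Finset.sum_mul]
        simp [Finset.mul_sum, eProd_mul_e, smul_smul]
      have h2 : e η a * x = x * e η a :=
        (Subalgebra.mem_center_iff (R := 𝕜)).1 hx (e η a)
      have h3 : ∀ y z : Cl η, e η a * y = e η a * z → y = z := by
        intro y z hyz
        have h := congrArg (e η a * ·) hyz
        simp only [← mul_assoc, e_mul_self, smul_mul_assoc, one_mul] at h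
        have h0 : η a ≠ 0 := by rcases hη a with h | h <;> simp [h]
        exact smul_right_injective _ h0 h
      have h4 := h3 _ _ (h2.trans h1)
      have h5 := congrArg (fun y => (eBasis η).repr y s) h4
      rw [Module.Basis.repr_sum_self] at h5
      exact mul_left_cancel₀ hs (by rw [← h5, mul_one])
    have key' : ∀ a, Even (s.card + if a ∈ s then 1 else 0) := fun a =>
      (neg_one_pow_eq_one_iff_even (by norm_num)).1 (key a)
    rcases s.eq_empty_or_nonempty with rfl | ⟨a, ha⟩
    · left; rfl
    · right
      have h1 := key' a
      rw [if_pos ha] at h1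
      have h2 : s = Finset.univ := by
        refine Finset.eq_univ_of_forall fun b => ?_
        by_contra hb
        have h2 := key' b
        rw [if_neg hb] at h2
        grind
      rw [h2, Finset.card_univ, Fintype.card_fin] at h1 ⊢
      exact ⟨rfl, by grind⟩
  · refine Submodule.span_le.2 ?_
    rintro _ ⟨s, hs, rfl⟩
    refine (Subalgebra.mem_center_iff (R := 𝕜)).2 (commute_of_forall_e fun a => ?_)
    rw [eBasis_apply, eProd_mul_e]
    have : Even (s.card + if a ∈ s then 1 else 0) := by
      rcases hs with hs | ⟨hs, hn⟩
      · rw [Finset.card_eq_zero] at hs; simp [hs]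
      · have hs' : s = Finset.univ := by
          rw [← Finset.card_eq_iff_eq_univ, hs, Fintype.card_fin]
        rw [if_pos (by simp [hs']), hs]
        grind
    rw [this.neg_one_pow, one_smul]

/-! ### The volume element -/

variable (η) in
/-- The product of all the generators. -/
def vol : Cl η := eProd η Finset.univ

variable (η) in
theorem grade_sup_eq : grade η 0 ⊔ grade η n = Submodule.span 𝕜 {1, vol η} := by
  rw [grade_eq, grade_eq, gradeSet_sup, gradeSet]
  congr 1
  have : {s : Finset (Fin n) | s.card ∈ ({0} ∪ {n} : Set ℕ)} = {∅, Finset.univ} := by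
    ext s
    have := Finset.card_eq_iff_eq_univ s
    rw [Fintype.card_fin] at this
    simp [this, or_comm]
  rw [this, Set.image_pair, eBasis_apply, eBasis_apply, eProd_empty, vol]

/-- Reversing the order of the factors, `reverse T * T` telescopes for a monomial `T`. -/
theorem exists_reverse_mul_self (s : Finset (Fin n)) :
    ∃ c : 𝕜, CliffordAlgebra.reverse (eProd η s) * eProd η s = c • 1 := by
  induction s using Finset.induction_on_min with
  | empty => exact ⟨1, by simp⟩
  | insert b s hb ih =>
    obtain ⟨c, hc⟩ := ih
    refine ⟨c * η b, ?_⟩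
    have he : CliffordAlgebra.reverse (e η b) = e η b := CliffordAlgebra.reverse_ι _
    rw [eProd_insert η hb, CliffordAlgebra.reverse.map_mul, he, mul_assoc, ← mul_assoc (e η b),
      e_mul_self, smul_mul_assoc, one_mul, mul_smul_comm, hc, smul_smul, mul_comm]

theorem exists_vol_mul_vol : ∃ c : 𝕜, vol η * vol η = c • 1 := by
  obtain ⟨c, hc⟩ := exists_reverse_mul_self (η := η) Finset.univ
  rw [reverse_eProd, smul_mul_assoc] at hc
  refine ⟨(-1) ^ ((Finset.univ : Finset (Fin n)).card.choose 2) * c, ?_⟩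
  rw [mul_smul, ← hc, smul_smul, ← mul_pow]
  simp [vol]

/-- The algebra generated by the volume element. -/
def volAlg (η : Fin n → 𝕜) : Subalgebra 𝕜 (Cl η) :=
  (grade η 0 ⊔ grade η n).toSubalgebra
    (by rw [grade_sup_eq]; exact Submodule.subset_span (by simp))
    (by
      intro x y hx hy
      rw [grade_sup_eq, Submodule.mem_span_pair] at *
      obtain ⟨a, b, rfl⟩ := hx
      obtain ⟨a', b', rfl⟩ := hy
      obtain ⟨c, hc⟩ := exists_vol_mul_vol (η := η)
      refine ⟨a * a' + b * b' * c, a * b' + b * a', ?_⟩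
      simp only [add_mul, mul_add, smul_mul_assoc, mul_smul_comm, hc, one_mul, mul_one]
      module)

theorem mem_volAlg {x : Cl η} : x ∈ volAlg η ↔ x ∈ grade η 0 ⊔ grade η n := Iff.rfl

theorem mem_volAlg_iff {x : Cl η} : x ∈ volAlg η ↔ ∃ a b : 𝕜, a • 1 + b • vol η = x := by
  rw [mem_volAlg, grade_sup_eq, Submodule.mem_span_pair]

theorem vol_mul_e (a : Fin n) : vol η * e η a = (-1 : 𝕜) ^ (n + 1) • (e η a * vol η) := by
  simp [vol, eProd_mul_e]

theorem vol_mul_of_odd (hn : n % 2 = 1) (x : Cl η) : vol η * x = x * vol η := by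
  refine (commute_of_forall_e (fun a => ?_) x).symm
  rw [vol_mul_e, Even.neg_one_pow (by grind), one_smul]

theorem vol_mul_of_even (hn : n % 2 = 0) (x : Cl η) :
    vol η * x = CliffordAlgebra.involute x * vol η := by
  induction x using CliffordAlgebra.induction with
  | algebraMap r => rw [AlgHom.commutes]; exact (Algebra.commutes r _).symm
  | ι v =>
    have h : ∀ a, vol η * e η a = -e η a * vol η := fun a => by
      rw [vol_mul_e, Odd.neg_one_pow (by grind)]; simp
    rw [CliffordAlgebra.involute_ι, ι_eq_sum, ← Finset.sum_neg_distrib]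
    simp only [Finset.sum_mul, Finset.mul_sum, mul_smul_comm, h, neg_mul, smul_neg, smul_mul_assoc]
  | mul y z hy hz => rw [← mul_assoc, hy, mul_assoc, hz, map_mul, mul_assoc]
  | add y z hy hz => rw [mul_add, map_add, add_mul, hy, hz]

end Center

/-! ### The action of the grade involution -/

section Groups

variable {𝕜 : Type*} [RCLike 𝕜] {n : ℕ} {η : Fin n → 𝕜}

instance instCompleteSpaceCl (η : Fin n → 𝕜) : CompleteSpace (Cl η) :=
  FiniteDimensional.complete 𝕜 (Cl η)

theorem involute_eProd' (s : Finset (Fin n)) :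
    (CliffordAlgebra.involute : Cl η →ₐ[𝕜] Cl η).toLinearMap (eProd η s) =
      (-1 : 𝕜) ^ s.card • eProd η s := involute_eProd s

theorem mem_parity_zero {x : Cl η} : x ∈ parity η 0 ↔ CliffordAlgebra.involute x = x := by
  have h := apply_mem_gradeSet_iff (η := η) (S := ∅) (x := x) (d := fun k => (-1) ^ k - 1)
    (f := (CliffordAlgebra.involute : Cl η →ₐ[𝕜] Cl η).toLinearMap - LinearMap.id)
    (fun s => by simp [involute_eProd, sub_smul])
  rw [parity_eq, ← sub_eq_zero]
  have h0 : gradeSet η ∅ = ⊥ := by simp [gradeSet]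
  rw [h0, Submodule.mem_bot] at h
  refine Iff.trans ?_ h.symm
  have : ∀ k : ℕ, (-1 : 𝕜) ^ k - 1 = 0 ↔ k % 2 = 0 := fun k => by
    rw [sub_eq_zero, neg_one_pow_eq_one_iff_even (by norm_num), Nat.even_iff]
  simp [this]

theorem mem_parity_one {x : Cl η} : x ∈ parity η 1 ↔ CliffordAlgebra.involute x = -x := by
  have h := apply_mem_gradeSet_iff (η := η) (S := ∅) (x := x) (d := fun k => (-1) ^ k + 1)
    (f := (CliffordAlgebra.involute : Cl η →ₐ[𝕜] Cl η).toLinearMap + LinearMap.id)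
    (fun s => by simp [involute_eProd, add_smul])
  rw [parity_eq, ← add_eq_zero_iff_eq_neg]
  have h0 : gradeSet η ∅ = ⊥ := by simp [gradeSet]
  rw [h0, Submodule.mem_bot] at h
  refine Iff.trans ?_ h.symm
  have : ∀ k : ℕ, (-1 : 𝕜) ^ k + 1 = 0 ↔ k % 2 = 1 := fun k => by
    rw [add_eq_zero_iff_eq_neg, neg_one_pow_eq_neg_one_iff_odd (by norm_num), Nat.odd_iff]
  simp [this]

theorem involute_mem_center (hη : ∀ a, η a = 1 ∨ η a = -1) {z : Cl η}
    (hz : z ∈ Subalgebra.center 𝕜 (Cl η)) :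
    CliffordAlgebra.involute z ∈ Subalgebra.center 𝕜 (Cl η) := by
  have hz' : z ∈ center η := hz
  change CliffordAlgebra.involute z ∈ center η
  rw [center_eq hη] at *
  refine (apply_mem_gradeSet_iff (f := CliffordAlgebra.involute.toLinearMap)
    (d := fun k => (-1) ^ k) involute_eProd').2 ?_
  exact gradeSet_le_iff.2 (fun k _ hk => Or.inr hk) hz'

/-- The components of odd grade of a central element change sign under the grade involution. -/
theorem exists_add_involute_of_mem_center (hη : ∀ a, η a = 1 ∨ η a = -1) {z : Cl η}
    (hz : z ∈ Subalgebra.center 𝕜 (Cl η)) :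
    ∃ c : 𝕜, z + CliffordAlgebra.involute z = (2 * c) • 1 := by
  have hz' : z ∈ center η := hz
  rw [center_eq hη] at hz'
  have h := (apply_mem_gradeSet_iff (η := η) (S := {0}) (x := z) (d := fun k => 1 + (-1) ^ k)
    (f := LinearMap.id + (CliffordAlgebra.involute : Cl η →ₐ[𝕜] Cl η).toLinearMap)
    (fun s => by simp [involute_eProd, add_smul])).2 ?_
  · rw [gradeSet] at h
    have h0 : {s : Finset (Fin n) | s.card ∈ ({0} : Set ℕ)} = {∅} := by ext s; simp
    rw [h0, Set.image_singleton, Submodule.mem_span_singleton, eBasis_apply, eProd_empty] at h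
    obtain ⟨c, hc⟩ := h
    exact ⟨c / 2, by rw [mul_div_cancel₀ _ two_ne_zero, hc]; rfl⟩
  · refine gradeSet_le_iff.2 (fun k _ hk => ?_) hz'
    rcases hk with hk | ⟨rfl, hk⟩
    · exact Or.inr hk
    · left
      rw [Odd.neg_one_pow (Nat.odd_iff.2 hk), add_neg_cancel]

/-- If `1 + w` is invertible for a central `w`, and `S = (1 + w) * T`, then `T` is `S` up to an
invertible central factor. -/
theorem mem_unitsIn_center_mul {w : Cl η} (hw : w ∈ Subalgebra.center 𝕜 (Cl η)) (hu : IsUnit w)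
    {T : (Cl η)ˣ} {S : Submodule 𝕜 (Cl η)} (hS : w * T ∈ S) :
    T ∈ unitsIn (center η) * unitsIn S := by
  obtain ⟨u, rfl⟩ := hu
  refine Set.mem_mul.2 ⟨u⁻¹, inv_mem_of_mem _ hw, u * T, hS, by simp⟩

theorem groupP_eq (hη : ∀ a, η a = 1 ∨ η a = -1) :
    groupP η = (twistGroup (𝕜 := 𝕜) (CliffordAlgebra.involute : Cl η →ₐ[𝕜] Cl η) : Set (Cl η)ˣ) := by
  ext T
  constructor
  · rintro ⟨z, hz, x, hx, rfl⟩
    have hz' : (z : Cl η) ∈ Subalgebra.center 𝕜 (Cl η) := hz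
    refine mul_mem (S := Subgroup (Cl η)ˣ) ?_ ?_
    · exact mul_mem (involute_mem_center hη hz') (inv_mem_of_mem _ hz')
    · rw [mem_twistGroup]
      rcases hx with hx | hx
      · rw [mem_parity_zero.1 hx, Units.mul_inv]
        exact one_mem _
      · rw [mem_parity_one.1 hx, neg_mul, Units.mul_inv]
        exact neg_mem (one_mem _)
  · intro hT
    -- With `θ T = w * T`, the even part of `T` is half of `(1 + w) * T`, and the odd part is half of
    -- `(1 - w) * T`. Since `w + θ w` is a scalar and `w * θ w = 1`, one of the central factors
    -- `1 + w` and `1 - w` is invertible.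
    have hw : CliffordAlgebra.involute (T : Cl η) * (T⁻¹ : (Cl η)ˣ) ∈
      Subalgebra.center 𝕜 (Cl η) := hT
    set w : Cl η := CliffordAlgebra.involute (T : Cl η) * (T⁻¹ : (Cl η)ˣ) with hwdef
    have hwT : CliffordAlgebra.involute (T : Cl η) = w * T := by rw [hwdef]; simp
    have hw1 : w * CliffordAlgebra.involute w = 1 := by
      have h := congrArg CliffordAlgebra.involute hwT
      rw [CliffordAlgebra.involute_involute, map_mul, hwT, ← mul_assoc] at h
      have h' := congrArg (· * ((T⁻¹ : (Cl η)ˣ) : Cl η)) h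
      simp only [mul_assoc, Units.mul_inv, mul_one] at h'
      rw [h']
      exact (Subalgebra.mem_center_iff (R := 𝕜)).1 (involute_mem_center hη hw) w
    obtain ⟨c, hc⟩ := exists_add_involute_of_mem_center hη hw
    have hww : ∀ r : 𝕜, (1 + r • w) * (1 + r • CliffordAlgebra.involute w) =
        (1 + 2 * c * r + r * r) • 1 := by
      intro r
      have : (1 + r • w) * (1 + r • CliffordAlgebra.involute w) =
          1 + r • (w + CliffordAlgebra.involute w) +
            (r * r) • (w * CliffordAlgebra.involute w) := by
        simp only [add_mul, mul_add, smul_mul_assoc, mul_smul_comm, one_mul, mul_one]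
        module
      rw [this, hc, hw1]
      module
    have hcen : ∀ r : 𝕜, 1 + r • w ∈ Subalgebra.center 𝕜 (Cl η) := fun r =>
      add_mem (one_mem _) (Subalgebra.smul_mem _ hw r)
    have hunit : ∀ r : 𝕜, 1 + 2 * c * r + r * r ≠ 0 → IsUnit (1 + r • w) := by
      intro r hr
      have h1 : (1 + r • w) * ((1 + 2 * c * r + r * r)⁻¹ •
          (1 + r • CliffordAlgebra.involute w)) = 1 := by
        rw [mul_smul_comm, hww, smul_smul, inv_mul_cancel₀ hr, one_smul]
      exact ⟨⟨_, _, h1, ((Subalgebra.mem_center_iff (R := 𝕜)).1 (hcen r) _).trans h1⟩, rfl⟩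
    have hθθ : CliffordAlgebra.involute (w * (T : Cl η)) = T := by
      rw [← hwT, CliffordAlgebra.involute_involute]
    by_cases hc1 : c = -1
    · have := mem_unitsIn_center_mul (hcen (-1)) (hunit (-1) (by rw [hc1]; norm_num))
        (T := T) (S := parity η 1) (by
          rw [mem_parity_one, add_mul, one_mul, smul_mul_assoc, map_add, map_smul, hθθ, hwT]
          module)
      exact Set.mul_subset_mul_left Set.subset_union_right this
    · have := mem_unitsIn_center_mul (hcen 1) (hunit 1 (by
          intro h
          apply hc1
          have h2 : (2 : 𝕜) * (c + 1) = 0 := by linear_combination h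
          rcases mul_eq_zero.1 h2 with h3 | h3
          · exact absurd h3 two_ne_zero
          · exact eq_neg_of_add_eq_zero_left h3))
        (T := T) (S := parity η 0) (by
          rw [mem_parity_zero, add_mul, one_mul, smul_mul_assoc, map_add, map_smul, hθθ, hwT]
          module)
      exact Set.mul_subset_mul_left Set.subset_union_left this

theorem twistLie_eq (hη : ∀ a, η a = 1 ∨ η a = -1) :
    twistLie (CliffordAlgebra.involute : Cl η →ₐ[𝕜] Cl η) =
      gradeSet η ({k | k % 2 = 0} ∪ centerGrades n) := by
  ext X
  have h := apply_mem_gradeSet_iff (η := η) (S := centerGrades n) (x := X)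
    (d := fun k => (-1) ^ k - 1)
    (f := (CliffordAlgebra.involute : Cl η →ₐ[𝕜] Cl η).toLinearMap - LinearMap.id)
    (fun s => by simp [involute_eProd, sub_smul])
  rw [← center_eq hη] at h
  have : ∀ k : ℕ, (-1 : 𝕜) ^ k - 1 = 0 ↔ k % 2 = 0 := fun k => by
    rw [sub_eq_zero, neg_one_pow_eq_one_iff_even (by norm_num), Nat.even_iff]
  simp only [this] at h
  exact h

end Groups

/-! ### Sums of binomial coefficients over residue classes modulo `4` -/

section Binomial

/-- The coefficients of `(1 + i) ^ n = ∑ k, n.choose k * i ^ k`, computed with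
`1 + i = √2 * exp (i π / 4)`. -/
theorem sum_choose_mul_I_pow (n : ℕ) :
    ∑ k ∈ Finset.range (n + 1), (n.choose k : ℂ) * Complex.I ^ k =
      ((2 : ℝ) ^ ((n : ℝ) / 2) * Real.cos (Real.pi * n / 4) : ℝ) +
        ((2 : ℝ) ^ ((n : ℝ) / 2) * Real.sin (Real.pi * n / 4) : ℝ) * Complex.I := by
  have h1 : ∑ k ∈ Finset.range (n + 1), (n.choose k : ℂ) * Complex.I ^ k =
      (1 + Complex.I) ^ n := by
    rw [add_comm (1 : ℂ), add_pow]
    exact Finset.sum_congr rfl fun k _ => by rw [one_pow, mul_one, mul_comm]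
  have h2 : (1 + Complex.I) =
      (√2 : ℝ) * (Complex.cos (Real.pi / 4 : ℝ) + Complex.sin (Real.pi / 4 : ℝ) * Complex.I) := by
    rw [← Complex.ofReal_cos, ← Complex.ofReal_sin, Real.cos_pi_div_four, Real.sin_pi_div_four]
    have h3 : ((√2 : ℝ) : ℂ) * ((√2 / 2 : ℝ) : ℂ) = 1 := by
      rw [← Complex.ofReal_mul, ← mul_div_assoc, Real.mul_self_sqrt (by norm_num)]
      norm_num
    linear_combination (-1 - Complex.I) * h3
  have h4 : (2 : ℝ) ^ ((n : ℝ) / 2) = √2 ^ n := by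
    rw [Real.sqrt_eq_rpow, ← Real.rpow_natCast, ← Real.rpow_mul (by norm_num)]
    congr 1; ring
  rw [h1, h2, mul_pow, Complex.cos_add_sin_mul_I_pow, h4]
  push_cast
  rw [show (n : ℂ) * (Real.pi / 4) = Real.pi * n / 4 by ring]
  ring

/-- The sum of the binomial coefficients `n.choose k` with `k ≡ j` modulo `4`. -/
def chooseMod (n j : ℕ) : ℝ :=
  ∑ k ∈ Finset.range (n + 1), if k % 4 = j then (n.choose k : ℝ) else 0

theorem I_pow_eq (k : ℕ) : Complex.I ^ k =
    ((if k % 4 = 0 then 1 else 0) - (if k % 4 = 2 then 1 else 0) : ℝ) +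
      ((if k % 4 = 1 then 1 else 0) - (if k % 4 = 3 then 1 else 0) : ℝ) * Complex.I := by
  rw [Complex.I_pow_eq_pow_mod]
  have : k % 4 < 4 := Nat.mod_lt _ (by norm_num)
  interval_cases k % 4 <;> simp [Complex.I_sq, Complex.I_pow_three]

theorem chooseMod_sub (n : ℕ) :
    chooseMod n 0 - chooseMod n 2 = (2 : ℝ) ^ ((n : ℝ) / 2) * Real.cos (Real.pi * n / 4) ∧
      chooseMod n 1 - chooseMod n 3 = (2 : ℝ) ^ ((n : ℝ) / 2) * Real.sin (Real.pi * n / 4) := by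
  have h := sum_choose_mul_I_pow n
  have h1 : ∑ k ∈ Finset.range (n + 1), (n.choose k : ℂ) * Complex.I ^ k =
      (chooseMod n 0 - chooseMod n 2 : ℝ) + (chooseMod n 1 - chooseMod n 3 : ℝ) * Complex.I := by
    simp only [chooseMod, ← Finset.sum_sub_distrib, Complex.ofReal_sum, Finset.sum_mul,
      ← Finset.sum_add_distrib]
    refine Finset.sum_congr rfl fun k _ => ?_
    rw [I_pow_eq]
    split_ifs <;> simp <;> ring
  rw [h1] at h
  have hre := congrArg Complex.re h
  have him := congrArg Complex.im h
  simp only [Complex.add_re, Complex.add_im, Complex.ofReal_re, Complex.ofReal_im,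
    Complex.re_ofReal_mul, Complex.im_ofReal_mul, Complex.I_re, Complex.I_im, mul_zero, mul_one,
    add_zero, zero_add] at hre him
  exact ⟨hre, him⟩

theorem chooseMod_add (n : ℕ) (hn : 1 ≤ n) :
    chooseMod n 0 + chooseMod n 2 = (2 : ℝ) ^ ((n : ℝ) - 1) ∧
      chooseMod n 1 + chooseMod n 3 = (2 : ℝ) ^ ((n : ℝ) - 1) := by
  have h1 : ∑ k ∈ Finset.range (n + 1), (n.choose k : ℝ) = (2 : ℝ) ^ n := by
    exact_mod_cast Nat.sum_range_choose n
  have h2 : ∑ k ∈ Finset.range (n + 1), (-1 : ℝ) ^ k * (n.choose k : ℝ) = 0 := by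
    exact_mod_cast Int.alternating_sum_range_choose_of_ne (n := n) (by omega)
  have h3 : (2 : ℝ) ^ ((n : ℝ) - 1) = (2 : ℝ) ^ n / 2 := by
    rw [Real.rpow_sub_one (by norm_num), Real.rpow_natCast]
  have h4 : (chooseMod n 0 + chooseMod n 2) + (chooseMod n 1 + chooseMod n 3) = (2 : ℝ) ^ n := by
    rw [← h1]
    simp only [chooseMod, ← Finset.sum_add_distrib]
    refine Finset.sum_congr rfl fun k _ => ?_
    have : k % 4 < 4 := Nat.mod_lt _ (by norm_num)
    interval_cases k % 4 <;> simp
  have h5 : (chooseMod n 0 + chooseMod n 2) - (chooseMod n 1 + chooseMod n 3) = 0 := by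
    rw [← h2]
    simp only [chooseMod, ← Finset.sum_add_distrib, ← Finset.sum_sub_distrib]
    refine Finset.sum_congr rfl fun k _ => ?_
    rcases Nat.even_or_odd k with hk | hk
    · rw [hk.neg_one_pow]
      rw [Nat.even_iff] at hk
      have h : k % 4 = 0 ∨ k % 4 = 2 := by omega
      rcases h with h | h <;> simp [h]
    · rw [hk.neg_one_pow]
      rw [Nat.odd_iff] at hk
      have h : k % 4 = 1 ∨ k % 4 = 3 := by omega
      rcases h with h | h <;> simp [h]
  rw [h3]
  constructor <;> linarith

theorem chooseMod_two (n : ℕ) (hn : 1 ≤ n) : chooseMod n 2 =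
    (2 : ℝ) ^ ((n : ℝ) - 2) - (2 : ℝ) ^ (((n : ℝ) - 2) / 2) * Real.cos (Real.pi * n / 4) := by
  have h1 := (chooseMod_sub n).1
  have h2 := (chooseMod_add n hn).1
  have h3 : (2 : ℝ) ^ ((n : ℝ) - 2) = (2 : ℝ) ^ ((n : ℝ) - 1) / 2 := by
    rw [← Real.rpow_sub_one (by norm_num)]; congr 1; ring
  have h4 : (2 : ℝ) ^ (((n : ℝ) - 2) / 2) = (2 : ℝ) ^ ((n : ℝ) / 2) / 2 := by
    rw [← Real.rpow_sub_one (by norm_num)]; congr 1; ring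
  rw [h3, h4]
  linarith

theorem two_rpow_half_mul_sqrt (x : ℝ) :
    (2 : ℝ) ^ (x / 2) = (2 : ℝ) ^ ((x - 1) / 2) * √2 := by
  rw [Real.sqrt_eq_rpow, ← Real.rpow_add (by norm_num)]
  congr 1; ring

theorem chooseMod_two_add_three (n : ℕ) (hn : 1 ≤ n) : chooseMod n 2 + chooseMod n 3 =
    (2 : ℝ) ^ ((n : ℝ) - 1) -
      (2 : ℝ) ^ (((n : ℝ) - 1) / 2) * Real.sin (Real.pi * ((n : ℝ) + 1) / 4) := by
  obtain ⟨h1, h1'⟩ := chooseMod_sub n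
  obtain ⟨h2, h2'⟩ := chooseMod_add n hn
  have h3 : Real.sin (Real.pi * ((n : ℝ) + 1) / 4) =
      (Real.sin (Real.pi * n / 4) + Real.cos (Real.pi * n / 4)) * (√2 / 2) := by
    rw [show Real.pi * ((n : ℝ) + 1) / 4 = Real.pi * n / 4 + Real.pi / 4 by ring, Real.sin_add,
      Real.cos_pi_div_four, Real.sin_pi_div_four]
    ring
  rw [two_rpow_half_mul_sqrt] at h1 h1'
  rw [h3]
  linear_combination (h2 + h2' - h1 - h1') / 2

theorem chooseMod_one_add_two (n : ℕ) (hn : 1 ≤ n) : chooseMod n 1 + chooseMod n 2 =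
    (2 : ℝ) ^ ((n : ℝ) - 1) -
      (2 : ℝ) ^ (((n : ℝ) - 1) / 2) * Real.cos (Real.pi * ((n : ℝ) + 1) / 4) := by
  obtain ⟨h1, h1'⟩ := chooseMod_sub n
  obtain ⟨h2, h2'⟩ := chooseMod_add n hn
  have h3 : Real.cos (Real.pi * ((n : ℝ) + 1) / 4) =
      (Real.cos (Real.pi * n / 4) - Real.sin (Real.pi * n / 4)) * (√2 / 2) := by
    rw [show Real.pi * ((n : ℝ) + 1) / 4 = Real.pi * n / 4 + Real.pi / 4 by ring, Real.cos_add,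
      Real.cos_pi_div_four, Real.sin_pi_div_four]
    ring
  rw [two_rpow_half_mul_sqrt] at h1 h1'
  rw [h3]
  linear_combination (h2 + h2' - h1 + h1') / 2

variable {𝕜 : Type*} [RCLike 𝕜] {n : ℕ} {η : Fin n → 𝕜}

/-- The dimension of a sum of grades that is the union of the residue classes in `J` modulo `4`
and of a set `E` of single grades outside of these classes. -/
theorem finrank_gradeSet_eq_sum_chooseMod {S : Set ℕ} (J E : Finset ℕ)
    (hE : ∀ k ∈ E, k % 4 ∉ J ∧ k ≤ n) (hS : ∀ k ≤ n, k ∈ S ↔ k % 4 ∈ J ∨ k ∈ E) :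
    (Module.finrank 𝕜 (gradeSet η S) : ℝ) =
      ∑ j ∈ J, chooseMod n j + ∑ k ∈ E, (n.choose k : ℝ) := by
  classical
  rw [finrank_gradeSet]
  simp only [chooseMod]
  have hE' : E = (Finset.range (n + 1)).filter (· ∈ E) := by
    ext k
    simp only [Finset.mem_filter, Finset.mem_range]
    exact ⟨fun h => ⟨by have := (hE k h).2; omega, h⟩, fun h => h.2⟩
  rw [Finset.sum_comm]
  conv_rhs => rw [hE', Finset.sum_filter, ← Finset.sum_add_distrib]
  rw [Nat.cast_sum]
  refine Finset.sum_congr rfl fun k hk => ?_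
  rw [Finset.sum_ite_eq]
  have h1 := hS k (by simpa [Nat.lt_succ_iff] using hk)
  simp only [h1, Nat.cast_ite, Nat.cast_zero]
  by_cases hJ : k % 4 ∈ J
  · have hk' : k ∉ E := fun h => (hE k h).1 hJ
    simp [hJ, hk']
  · simp [hJ]

end Binomial

/-! ### Identification of the groups and of their Lie algebras -/

section Main

variable {𝕜 : Type*} [RCLike 𝕜] {n : ℕ} {η : Fin n → 𝕜}

/-- Clifford conjugation: the grade involution of the reversion. -/
def conj (η : Fin n → 𝕜) : Cl η →ₗ[𝕜] Cl η :=
  (CliffordAlgebra.involute : Cl η →ₐ[𝕜] Cl η).toLinearMap ∘ₗ CliffordAlgebra.reverse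

theorem conj_apply (x : Cl η) :
    conj η x = CliffordAlgebra.involute (CliffordAlgebra.reverse x) := rfl

theorem conj_one : conj η 1 = 1 := by
  rw [conj_apply, CliffordAlgebra.reverse.map_one, map_one]

theorem conj_mul (x y : Cl η) : conj η (x * y) = conj η y * conj η x := by
  simp only [conj_apply, CliffordAlgebra.reverse.map_mul, map_mul]

/-- The signs of the Clifford conjugation are those of the reversion, shifted by one grade. -/
theorem conj_eProd (s : Finset (Fin n)) :
    conj η (eProd η s) = (-1 : 𝕜) ^ ((s.card + 1).choose 2) • eProd η s := by
  rw [conj_apply, reverse_eProd, map_smul, involute_eProd, smul_smul, Nat.choose_succ_succ' s.card 1,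
    Nat.choose_one_right, pow_add, mul_comm]

theorem neg_one_pow_choose_two_add_one_eq_zero (k : ℕ) :
    (-1 : 𝕜) ^ (k.choose 2) + 1 = 0 ↔ 2 ≤ k % 4 := by
  rw [neg_one_pow_choose_two]
  split_ifs with h
  · simp [h]
  · simpa [Nat.lt_iff_add_one_le] using h

/-- `τ T * T` is invertible for an invertible `T`, so only its membership matters. -/
theorem exists_unitsIn_iff {τ : Cl η →ₗ[𝕜] Cl η} (hτ1 : τ 1 = 1)
    (hτ : ∀ x y, τ (x * y) = τ y * τ x) {S : Submodule 𝕜 (Cl η)} {T : (Cl η)ˣ} :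
    (∃ W ∈ unitsIn S, τ T * T = (W : Cl η)) ↔ τ T * T ∈ S := by
  constructor
  · rintro ⟨W, hW, h⟩
    rw [h]
    exact hW
  · intro h
    let u : (Cl η)ˣ := ⟨τ T, τ (T⁻¹ : (Cl η)ˣ), by rw [← hτ, Units.inv_mul, hτ1],
      by rw [← hτ, Units.mul_inv, hτ1]⟩
    exact ⟨u * T, h, rfl⟩

theorem normLie_eq {τ : Cl η →ₗ[𝕜] Cl η} {d : ℕ → 𝕜}
    (hτ : ∀ s, τ (eProd η s) = d s.card • eProd η s) {K : Subalgebra 𝕜 (Cl η)}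
    {L : Submodule 𝕜 (Cl η)} {S R : Set ℕ} (hK : Subalgebra.toSubmodule K = gradeSet η S)
    (hL : L = gradeSet η R) :
    normLie τ K L = gradeSet η (R ∩ {k | d k + 1 = 0 ∨ k ∈ S}) := by
  rw [← gradeSet_inf, ← hL]
  ext X
  rw [mem_normLie, Submodule.mem_inf, ← Subalgebra.mem_toSubmodule, hK]
  refine and_congr_right fun _ => ?_
  exact apply_mem_gradeSet_iff (η := η) (d := fun k => d k + 1) (f := τ + LinearMap.id)
    fun s => by simp [hτ, add_smul]

theorem gradeSet_univ : gradeSet η Set.univ = ⊤ := by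
  ext x; simp [mem_gradeSet]

/-- The closed subgroup theorem for the group of invertible elements of the Clifford algebra. -/
theorem IsClosedWithLieAlgebra.exists_lieSubalgebra {H : Subgroup (Cl η)ˣ}
    {F : Submodule 𝕜 (Cl η)} (h : IsClosedWithLieAlgebra H F) {G : Set (Cl η)ˣ}
    (hG : G = H) {S : Set ℕ} (hF : F = gradeSet η S) :
    ∃ 𝔤 : LieSubalgebra 𝕜 (Cl η), IsLieGroupWithLieAlgebra G 𝔤 ∧
      𝔤.toSubmodule = gradeSet η S := by
  subst hG hF
  refine ⟨{ gradeSet η S with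
    lie_mem' := fun {X Y} hX hY => h.commutator_mem X hX Y hY }, ⟨⟨H, rfl⟩, ?_, fun X => ?_⟩, rfl⟩
  · exact isEmbeddedSubmanifold_of_isClosed h.isClosed h.mem_iff
  · refine (h.mem_iff X).trans (forall_congr' fun t => ⟨fun ht => ⟨_, ht, rfl⟩, ?_⟩)
    rintro ⟨T, hT, hTX⟩
    have : T = expUnit 𝕜 ((t : 𝕜) • X) := Units.ext hTX
    rwa [← this]

theorem mul_mul_inv_mem_center (T : (Cl η)ˣ) (k : Cl η) (hk : k ∈ Subalgebra.center 𝕜 (Cl η)) :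
    (T : Cl η) * k * (T⁻¹ : (Cl η)ˣ) ∈ Subalgebra.center 𝕜 (Cl η) := by
  rw [(Subalgebra.mem_center_iff (R := 𝕜)).1 hk T, mul_assoc, Units.mul_inv, mul_one]
  exact hk

theorem commute_of_mem_center (X k : Cl η) (hk : k ∈ Subalgebra.center 𝕜 (Cl η)) :
    Commute X k := (Subalgebra.mem_center_iff (R := 𝕜)).1 hk X

/-- The scalars are the whole center when `n` is even. -/
theorem exists_smul_one_of_mem_center (hη : ∀ a, η a = 1 ∨ η a = -1) (hn : n % 2 = 0) {z : Cl η}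
    (hz : z ∈ Subalgebra.center 𝕜 (Cl η)) : ∃ c : 𝕜, z = c • 1 := by
  have hz' : z ∈ center η := hz
  rw [center_eq hη, gradeSet] at hz'
  have h0 : {s : Finset (Fin n) | s.card ∈ centerGrades n} = {∅} := by
    ext s; simp [centerGrades, hn]
  rw [h0, Set.image_singleton, Submodule.mem_span_singleton, eBasis_apply, eProd_empty] at hz'
  obtain ⟨c, hc⟩ := hz'
  exact ⟨c, hc.symm⟩

/-- Elements of the group `P` commute with the volume element up to a scalar. -/
theorem mul_mul_inv_mem_volAlg (hη : ∀ a, η a = 1 ∨ η a = -1) (T : (Cl η)ˣ)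
    (hT : T ∈ twistGroup (𝕜 := 𝕜) (CliffordAlgebra.involute : Cl η →ₐ[𝕜] Cl η)) (k : Cl η)
    (hk : k ∈ volAlg η) : (T : Cl η) * k * (T⁻¹ : (Cl η)ˣ) ∈ volAlg η := by
  have hvol : ∃ c : 𝕜, (T : Cl η) * vol η * (T⁻¹ : (Cl η)ˣ) = c • vol η := by
    rcases Nat.mod_two_eq_zero_or_one n with hn | hn
    · obtain ⟨c, hc⟩ := exists_smul_one_of_mem_center hη hn (mem_twistGroup.1 (inv_mem hT))
      rw [inv_inv] at hc
      have h : CliffordAlgebra.involute ((T⁻¹ : (Cl η)ˣ) : Cl η) = c • (T⁻¹ : (Cl η)ˣ) := by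
        rw [← Units.mul_left_inj T, hc, smul_mul_assoc, Units.inv_mul]
      refine ⟨c, ?_⟩
      rw [mul_assoc, vol_mul_of_even hn, h, smul_mul_assoc, mul_smul_comm, ← mul_assoc,
        Units.mul_inv, one_mul]
    · exact ⟨1, by rw [← vol_mul_of_odd hn, mul_assoc, Units.mul_inv, mul_one, one_smul]⟩
  obtain ⟨a, b, rfl⟩ := mem_volAlg_iff.1 hk
  obtain ⟨c, hc⟩ := hvol
  refine mem_volAlg_iff.2 ⟨a, b * c, ?_⟩
  simp only [mul_add, add_mul, mul_smul_comm, smul_mul_assoc, hc, mul_one, Units.mul_inv, mul_smul]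

theorem commute_of_mem_volAlg (hη : ∀ a, η a = 1 ∨ η a = -1) (X : Cl η)
    (hX : X ∈ twistLie (CliffordAlgebra.involute : Cl η →ₐ[𝕜] Cl η)) (k : Cl η)
    (hk : k ∈ volAlg η) : Commute X k := by
  obtain ⟨a, b, rfl⟩ := mem_volAlg_iff.1 hk
  refine ((Commute.one_right X).smul_right a).add_right (Commute.smul_right ?_ b)
  rcases Nat.mod_two_eq_zero_or_one n with hn | hn
  · have h : CliffordAlgebra.involute X = X := by
      rw [← mem_parity_zero, parity_eq]
      rw [twistLie_eq hη] at hX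
      refine gradeSet_le_iff.2 (fun k _ hk => ?_) hX
      rcases hk with hk | rfl | hk
      · exact hk
      · rfl
      · omega
    have := vol_mul_of_even hn X
    rw [h] at this
    exact this.symm
  · exact (vol_mul_of_odd hn X).symm

theorem exists_lieAlgebraP (hη : ∀ a, η a = 1 ∨ η a = -1) :
    ∃ 𝔤 : LieSubalgebra 𝕜 (Cl η), IsLieGroupWithLieAlgebra (groupP η) 𝔤 ∧
      𝔤.toSubmodule = gradeSet η ({k | k % 2 = 0} ∪ centerGrades n) :=
  (isClosedWithLieAlgebra_twist _).exists_lieSubalgebra (groupP_eq hη) (twistLie_eq hη)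

theorem exists_lieAlgebraA (hη : ∀ a, η a = 1 ∨ η a = -1) :
    ∃ 𝔤 : LieSubalgebra 𝕜 (Cl η), IsLieGroupWithLieAlgebra (groupA η) 𝔤 ∧
      𝔤.toSubmodule = gradeSet η ({k | 2 ≤ k % 4} ∪ centerGrades n) := by
  refine (isClosedWithLieAlgebra_norm CliffordAlgebra.reverse.map_one
    CliffordAlgebra.reverse.map_mul (fun T _ => mul_mul_inv_mem_center T)
    isClosedWithLieAlgebra_top fun X _ => commute_of_mem_center X).exists_lieSubalgebra ?_ ?_
  · ext T
    exact (exists_unitsIn_iff CliffordAlgebra.reverse.map_one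
      CliffordAlgebra.reverse.map_mul).trans (and_iff_right trivial).symm
  · rw [normLie_eq (d := fun k => (-1) ^ (k.choose 2)) reverse_eProd (center_eq hη) gradeSet_univ.symm, gradeSet_eq_iff]
    intro k _
    simp [neg_one_pow_choose_two_add_one_eq_zero]

theorem exists_lieAlgebraB (hη : ∀ a, η a = 1 ∨ η a = -1) :
    ∃ 𝔤 : LieSubalgebra 𝕜 (Cl η), IsLieGroupWithLieAlgebra (groupB η) 𝔤 ∧
      𝔤.toSubmodule = gradeSet η ({k | 2 ≤ (k + 1) % 4} ∪ centerGrades n) := by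
  refine (isClosedWithLieAlgebra_norm conj_one conj_mul (fun T _ => mul_mul_inv_mem_center T)
    isClosedWithLieAlgebra_top fun X _ => commute_of_mem_center X).exists_lieSubalgebra ?_ ?_
  · ext T
    exact (exists_unitsIn_iff conj_one conj_mul).trans (and_iff_right trivial).symm
  · rw [normLie_eq (d := fun k => (-1) ^ ((k + 1).choose 2)) conj_eProd (center_eq hη)
      gradeSet_univ.symm, gradeSet_eq_iff]
    intro k _
    simp [neg_one_pow_choose_two_add_one_eq_zero]

theorem exists_lieAlgebraQ (hη : ∀ a, η a = 1 ∨ η a = -1) :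
    ∃ 𝔤 : LieSubalgebra 𝕜 (Cl η), IsLieGroupWithLieAlgebra (groupQ η) 𝔤 ∧
      𝔤.toSubmodule = gradeSet η ({k | k % 4 = 2} ∪ centerGrades n) := by
  refine (isClosedWithLieAlgebra_norm CliffordAlgebra.reverse.map_one
    CliffordAlgebra.reverse.map_mul (fun T _ => mul_mul_inv_mem_center T)
    (isClosedWithLieAlgebra_twist CliffordAlgebra.involute)
    fun X _ => commute_of_mem_center X).exists_lieSubalgebra ?_ ?_
  · ext T
    exact and_congr (Set.ext_iff.1 (groupP_eq hη) T) (exists_unitsIn_iff (S := center η)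
      CliffordAlgebra.reverse.map_one CliffordAlgebra.reverse.map_mul)
  · rw [normLie_eq (d := fun k => (-1) ^ (k.choose 2)) reverse_eProd (center_eq hη) (twistLie_eq hη), gradeSet_eq_iff]
    intro k _
    simp only [neg_one_pow_choose_two_add_one_eq_zero, centerGrades, Set.mem_inter_iff,
      Set.mem_union, Set.mem_ofPred_eq]
    omega

theorem exists_lieAlgebraQ' (hη : ∀ a, η a = 1 ∨ η a = -1) :
    ∃ 𝔤 : LieSubalgebra 𝕜 (Cl η), IsLieGroupWithLieAlgebra (groupQ' η) 𝔤 ∧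
      𝔤.toSubmodule = gradeSet η ({k | k % 4 = 2} ∪ {0, n}) := by
  have hP := isClosedWithLieAlgebra_twist (CliffordAlgebra.involute : Cl η →ₐ[𝕜] Cl η)
  refine (isClosedWithLieAlgebra_norm (K := volAlg η) CliffordAlgebra.reverse.map_one
    CliffordAlgebra.reverse.map_mul (mul_mul_inv_mem_volAlg hη) hP
    (commute_of_mem_volAlg hη)).exists_lieSubalgebra ?_ ?_
  · ext T
    rw [SetLike.mem_coe, mem_normGroup, mem_volAlg]
    exact and_congr (Set.ext_iff.1 (groupP_eq hη) T) (exists_unitsIn_iff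
      CliffordAlgebra.reverse.map_one CliffordAlgebra.reverse.map_mul)
  · have hK : Subalgebra.toSubmodule (volAlg η) = gradeSet η {0, n} := by
      have : Subalgebra.toSubmodule (volAlg η) = grade η 0 ⊔ grade η n := by
        ext x; exact mem_volAlg
      rw [this, grade_eq, grade_eq, gradeSet_sup]
      rfl
    rw [normLie_eq (d := fun k => (-1) ^ (k.choose 2)) reverse_eProd hK (twistLie_eq hη), gradeSet_eq_iff]
    intro k _
    simp only [neg_one_pow_choose_two_add_one_eq_zero, centerGrades, Set.mem_inter_iff,
      Set.mem_union, Set.mem_ofPred_eq, Set.mem_insert_iff, Set.mem_singleton_iff]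
    omega

theorem finrank_eq_of_toSubmodule_eq {𝔤 : LieSubalgebra 𝕜 (Cl η)} {F : Submodule 𝕜 (Cl η)}
    (h : 𝔤.toSubmodule = F) : Module.finrank 𝕜 𝔤 = Module.finrank 𝕜 F := by
  rw [← h]; rfl

theorem gammaAlg_eq :
    gammaAlg η = gradeSet η ({0, 2} ∪ {k | k = n ∧ n % 2 = 1}) := by
  rw [gammaAlg]
  split_ifs with h
  · rw [Nat.even_iff] at h
    simp only [grade_eq, gradeSet_sup, gradeSet_eq_iff, Set.mem_union, Set.mem_ofPred_eq,
      Set.mem_insert_iff, Set.mem_singleton_iff]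
    omega
  · rw [Nat.even_iff] at h
    simp only [grade_eq, gradeSet_sup, gradeSet_eq_iff, Set.mem_union, Set.mem_ofPred_eq,
      Set.mem_insert_iff, Set.mem_singleton_iff]
    omega

end Main

end CliffordLie

end

theorem theorem9p1 {𝕜 : Type*} [RCLike 𝕜] (n : ℕ) (hn : 1 ≤ n)
    (η : Fin n → 𝕜) (hη : ∀ a, η a = 1 ∨ η a = -1) :
    ∃ 𝔭 𝔞 𝔟 𝔮 𝔮' : LieSubalgebra 𝕜 (CliffordLie.Cl η),
      -- they are the Lie algebras of the five Lie groups
      CliffordLie.IsLieGroupWithLieAlgebra (CliffordLie.groupP η) 𝔭 ∧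
      CliffordLie.IsLieGroupWithLieAlgebra (CliffordLie.groupA η) 𝔞 ∧
      CliffordLie.IsLieGroupWithLieAlgebra (CliffordLie.groupB η) 𝔟 ∧
      CliffordLie.IsLieGroupWithLieAlgebra (CliffordLie.groupQ η) 𝔮 ∧
      CliffordLie.IsLieGroupWithLieAlgebra (CliffordLie.groupQ' η) 𝔮' ∧
      -- explicit form and dimension of `𝔭`
      (n % 2 = 1 →
        𝔭.toSubmodule = CliffordLie.parity η 0 ⊔ CliffordLie.grade η n ∧
        (Module.finrank 𝕜 𝔭 : ℝ) = (2 : ℝ) ^ ((n : ℝ) - 1) + 1) ∧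
      (n % 2 = 0 →
        𝔭.toSubmodule = CliffordLie.parity η 0 ∧
        (Module.finrank 𝕜 𝔭 : ℝ) = (2 : ℝ) ^ ((n : ℝ) - 1)) ∧
      -- explicit form and dimension of `𝔞`
      (n % 4 = 1 →
        𝔞.toSubmodule = CliffordLie.grade η 0 ⊔ CliffordLie.quat η 2 ⊔ CliffordLie.quat η 3 ⊔
          CliffordLie.grade η n ∧
        (Module.finrank 𝕜 𝔞 : ℝ) = (2 : ℝ) ^ ((n : ℝ) - 1) -
          (2 : ℝ) ^ (((n : ℝ) - 1) / 2) * Real.sin (Real.pi * ((n : ℝ) + 1) / 4) + 2) ∧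
      (n % 4 ≠ 1 →
        𝔞.toSubmodule = CliffordLie.grade η 0 ⊔ CliffordLie.quat η 2 ⊔ CliffordLie.quat η 3 ∧
        (Module.finrank 𝕜 𝔞 : ℝ) = (2 : ℝ) ^ ((n : ℝ) - 1) -
          (2 : ℝ) ^ (((n : ℝ) - 1) / 2) * Real.sin (Real.pi * ((n : ℝ) + 1) / 4) + 1) ∧
      -- explicit form and dimension of `𝔟`
      (n % 4 = 3 →
        𝔟.toSubmodule = CliffordLie.grade η 0 ⊔ CliffordLie.quat η 1 ⊔ CliffordLie.quat η 2 ⊔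
          CliffordLie.grade η n ∧
        (Module.finrank 𝕜 𝔟 : ℝ) = (2 : ℝ) ^ ((n : ℝ) - 1) -
          (2 : ℝ) ^ (((n : ℝ) - 1) / 2) * Real.cos (Real.pi * ((n : ℝ) + 1) / 4) + 2) ∧
      (n % 4 ≠ 3 →
        𝔟.toSubmodule = CliffordLie.grade η 0 ⊔ CliffordLie.quat η 1 ⊔ CliffordLie.quat η 2 ∧
        (Module.finrank 𝕜 𝔟 : ℝ) = (2 : ℝ) ^ ((n : ℝ) - 1) -
          (2 : ℝ) ^ (((n : ℝ) - 1) / 2) * Real.cos (Real.pi * ((n : ℝ) + 1) / 4) + 1) ∧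
      -- explicit form and dimension of `𝔮`
      (n % 2 = 1 →
        𝔮.toSubmodule = CliffordLie.grade η 0 ⊔ CliffordLie.quat η 2 ⊔ CliffordLie.grade η n ∧
        (Module.finrank 𝕜 𝔮 : ℝ) = (2 : ℝ) ^ ((n : ℝ) - 2) -
          (2 : ℝ) ^ (((n : ℝ) - 2) / 2) * Real.cos (Real.pi * (n : ℝ) / 4) + 2) ∧
      (n % 2 = 0 →
        𝔮.toSubmodule = CliffordLie.grade η 0 ⊔ CliffordLie.quat η 2 ∧
        (Module.finrank 𝕜 𝔮 : ℝ) = (2 : ℝ) ^ ((n : ℝ) - 2) -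
          (2 : ℝ) ^ (((n : ℝ) - 2) / 2) * Real.cos (Real.pi * (n : ℝ) / 4) + 1) ∧
      -- explicit form and dimension of `𝔮'`
      (n % 4 ≠ 2 →
        𝔮'.toSubmodule = CliffordLie.grade η 0 ⊔ CliffordLie.quat η 2 ⊔ CliffordLie.grade η n ∧
        (Module.finrank 𝕜 𝔮' : ℝ) = (2 : ℝ) ^ ((n : ℝ) - 2) -
          (2 : ℝ) ^ (((n : ℝ) - 2) / 2) * Real.cos (Real.pi * (n : ℝ) / 4) + 2) ∧
      (n % 4 = 2 →
        𝔮'.toSubmodule = CliffordLie.grade η 0 ⊔ CliffordLie.quat η 2 ∧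
        (Module.finrank 𝕜 𝔮' : ℝ) = (2 : ℝ) ^ ((n : ℝ) - 2) -
          (2 : ℝ) ^ (((n : ℝ) - 2) / 2) * Real.cos (Real.pi * (n : ℝ) / 4) + 1) ∧
      -- relations for all `n`
      CliffordLie.gammaAlg η ≤ 𝔮.toSubmodule ∧ 𝔮 ≤ 𝔭 ∧ 𝔮 ≤ 𝔞 ∧ 𝔮 ≤ 𝔟 ∧
      𝔮 = 𝔞 ⊓ 𝔭 ∧ 𝔮 = 𝔟 ⊓ 𝔭 ∧ 𝔮 = 𝔞 ⊓ 𝔟 ∧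
      -- relations in small dimensions
      (n ≤ 3 → 𝔮 = 𝔭 ∧ 𝔭 = 𝔞) ∧
      (n = 4 → 𝔮 ≠ 𝔭 ∧ 𝔮 ≠ 𝔞 ∧ 𝔭 ≠ 𝔞) ∧
      (n ≤ 5 → CliffordLie.gammaAlg η = 𝔮.toSubmodule) ∧
      (n = 6 → CliffordLie.gammaAlg η ≠ 𝔮.toSubmodule) ∧
      -- relations for `n` divisible by `4`
      (n % 4 = 0 →
        𝔮 ≤ 𝔮' ∧ 𝔮' ≤ 𝔭 ∧ CliffordLie.gammaAlg η ≤ 𝔮'.toSubmodule ∧ 𝔮 ≠ 𝔮' ∧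
        (n = 4 → 𝔮' = 𝔭) ∧ (8 ≤ n → 𝔮' ≠ 𝔭)) := by
  obtain ⟨𝔭, hp, h𝔭⟩ := CliffordLie.exists_lieAlgebraP hη
  obtain ⟨𝔞, ha, h𝔞⟩ := CliffordLie.exists_lieAlgebraA hη
  obtain ⟨𝔟, hb, h𝔟⟩ := CliffordLie.exists_lieAlgebraB hη
  obtain ⟨𝔮, hq, h𝔮⟩ := CliffordLie.exists_lieAlgebraQ hη
  obtain ⟨𝔮', hq', h𝔮'⟩ := CliffordLie.exists_lieAlgebraQ' hη
  refine ⟨𝔭, 𝔞, 𝔟, 𝔮, 𝔮', hp, ha, hb, hq, hq', ?_⟩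
  -- All relations, and the explicit forms, become statements about sets of grades `k ≤ n`.
  simp only [ne_eq, ← LieSubalgebra.toSubmodule_inj, ← LieSubalgebra.toSubmodule_le_toSubmodule,
    LieSubalgebra.inf_toSubmodule, CliffordLie.finrank_eq_of_toSubmodule_eq h𝔭,
    CliffordLie.finrank_eq_of_toSubmodule_eq h𝔞, CliffordLie.finrank_eq_of_toSubmodule_eq h𝔟,
    CliffordLie.finrank_eq_of_toSubmodule_eq h𝔮, CliffordLie.finrank_eq_of_toSubmodule_eq h𝔮',
    h𝔭, h𝔞, h𝔟, h𝔮, h𝔮', CliffordLie.gammaAlg_eq,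
    CliffordLie.grade_eq, CliffordLie.parity_eq, CliffordLie.quat_eq, CliffordLie.gradeSet_sup,
    CliffordLie.gradeSet_inf, CliffordLie.gradeSet_eq_iff, CliffordLie.gradeSet_le_iff,
    CliffordLie.mem_centerGrades, Set.mem_union, Set.mem_inter_iff, Set.mem_ofPred_eq,
    Set.mem_insert_iff, Set.mem_singleton_iff]
  refine ⟨fun h => ⟨by omega, ?_⟩, fun h => ⟨by omega, ?_⟩, fun h => ⟨by omega, ?_⟩,
    fun h => ⟨by omega, ?_⟩, fun h => ⟨by omega, ?_⟩, fun h => ⟨by omega, ?_⟩,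
    fun h => ⟨by omega, ?_⟩, fun h => ⟨by omega, ?_⟩, fun h => ⟨by omega, ?_⟩,
    fun h => ⟨by omega, ?_⟩, by omega, by omega, by omega, by omega, by omega, by omega, by omega,
    fun h => ⟨by omega, by omega⟩, ?_, by omega, ?_, ?_⟩
  · rw [CliffordLie.finrank_gradeSet_eq_sum_chooseMod {0, 2} {n}]
    · simp [(CliffordLie.chooseMod_add n hn).1]
    · intro k; simp; omega
    · intro k; simp; omega
  · rw [CliffordLie.finrank_gradeSet_eq_sum_chooseMod {0, 2} ∅]
    · simp [(CliffordLie.chooseMod_add n hn).1]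
    · intro k; simp
    · intro k; simp; omega
  · rw [← CliffordLie.chooseMod_two_add_three n hn,
      CliffordLie.finrank_gradeSet_eq_sum_chooseMod {2, 3} {0, n}]
    · rw [Finset.sum_pair (by omega : (0 : ℕ) ≠ n)]; simp; norm_num
    · intro k; simp; omega
    · intro k; simp; omega
  · rw [← CliffordLie.chooseMod_two_add_three n hn,
      CliffordLie.finrank_gradeSet_eq_sum_chooseMod {2, 3} {0}]
    · simp
    · intro k; simp; omega
    · intro k; simp; omega
  · rw [← CliffordLie.chooseMod_one_add_two n hn,
      CliffordLie.finrank_gradeSet_eq_sum_chooseMod {1, 2} {0, n}]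
    · rw [Finset.sum_pair (by omega : (0 : ℕ) ≠ n)]; simp; norm_num
    · intro k; simp; omega
    · intro k; simp; omega
  · rw [← CliffordLie.chooseMod_one_add_two n hn,
      CliffordLie.finrank_gradeSet_eq_sum_chooseMod {1, 2} {0}]
    · simp
    · intro k; simp; omega
    · intro k; simp; omega
  · rw [← CliffordLie.chooseMod_two n hn,
      CliffordLie.finrank_gradeSet_eq_sum_chooseMod {2} {0, n}]
    · rw [Finset.sum_pair (by omega : (0 : ℕ) ≠ n)]; simp; norm_num
    · intro k; simp; omega
    · intro k; simp; omega
  · rw [← CliffordLie.chooseMod_two n hn,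
      CliffordLie.finrank_gradeSet_eq_sum_chooseMod {2} {0}]
    · simp
    · intro k; simp; omega
    · intro k; simp; omega
  · rw [← CliffordLie.chooseMod_two n hn,
      CliffordLie.finrank_gradeSet_eq_sum_chooseMod {2} {0, n}]
    · rw [Finset.sum_pair (by omega : (0 : ℕ) ≠ n)]; simp; norm_num
    · intro k; simp; omega
    · intro k; simp; omega
  · rw [← CliffordLie.chooseMod_two n hn,
      CliffordLie.finrank_gradeSet_eq_sum_chooseMod {2} {0}]
    · simp
    · intro k; simp; omega
    · intro k; simp; omega
  · -- For `n = 4`, the grades `3` and `4` tell the three subspaces apart.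
    intro h
    refine ⟨fun h' => ?_, fun h' => ?_, fun h' => ?_⟩
    · have := h' 4; omega
    · have := h' 3; omega
    · have := h' 3; omega
  · intro h h'
    have := h' 6; omega
  · intro h
    refine ⟨by omega, by omega, by omega, fun h' => ?_, by omega, fun h8 h' => ?_⟩
    · -- Grade `n` belongs to `𝔮'` and not to `𝔮`.
      have := h' n; omega
    · -- Grade `4` belongs to `𝔭`, and to `𝔮'` only for `n = 4`.
      have := h' 4; omega
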